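/- Let $(\mathcal I,c)$ be a braided Ising category, i.e. a braided fusion category over $\mathbb C$ which is non-pointed of Frobenius--Perron dimension $4$, and let $f$ be a fermion of the form $(f,c_{-,f})$ in its Drinfeld center (so $f\otimes f\cong\mathbf 1$ and $c_{f,f}=-\mathrm{id}$). Let $G$ be a finite group. A super-group is given by a pair $(G,\alpha)$ with $\alpha\in H^2(G,\mathbb Z/2\mathbb Z)$, the class of a central extension of $G$ by $\mathbb Z/2\mathbb Z$; it is trivial if $\alpha=0$. A tensor autoequivalence $F$ of $\mathcal I$ is called fermionic if there is an isomorphism $F(f)\cong f$ compatible with the half-braidings $c_{V,f}$ and $c_{F(V),f}$ for all $V$; let $\underline{\mathrm{Aut}_\otimes(\mathcal I,f)}$ be the monoidal category of fermionic tensor autoequivalences and tensor natural isomorphisms. A fermionic action of $(G,\alpha)$ on $(\mathcal I,f)$ is a monoidal functor $\underline G\to\underline{\mathrm{Aut}_\otimes(\mathcal I,f)}$ from the discrete monoidal category $\underline G$ whose restriction $\underline G\to\underline{\mathrm{Aut}_\otimes(\langle f\rangle)}$ to the fusion subcategory generated by $f$ corresponds to $\alpha$: there are tensor isomorphisms $u_g:\mathrm{id}\to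 g_*$ on $\langle f\rangle$ and a $2$-cocycle $a$ representing $\alpha$ such that, at the object $f$, the composite $\mathrm{id}\to g_*\circ h_*\to (gh)_*$ of $u_g\otimes u_h$ with the monoidal structure equals $(-1)^{a(g,h)}u_{gh}$. Two actions are equivalent if they are isomorphic as monoidal functors. Then: (a) $(G,\alpha)$ has a fermionic action on $(\mathcal I,f)$ if and only if $\alpha=0$; that is, only trivial super-groups act fermionically on a spin-braided Ising category. (b) The equivalence classes of fermionic actions of $(G,0)$ on $(\mathcal I,f)$ are in bijection with $H^2(G,\mathbb Z/2\mathbb Z)$. More precisely, there is a bijection under which the class of an action corresponds to $\beta\in H^2(G,\mathbb Z/2\mathbb Z)$ if and only if there are tensor isomorphisms $u_g:\mathrm{id}_{\mathcal I}\to g_*$ and a $2$-cocycle $b$ representing $\beta$ such that, at a non-invertible simple object $\sigma$ (equivalently, at any such), the composite $\mathrm{id}\to g_*\circ h_*\to (gh)_*$ equals $(-1)^{b(g,h)}u_{gh}$. -/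

import Mathlib

open CategoryTheory MonoidalCategory Limits

universe v u

noncomputable section

/-! ## Fusion categories -/

section Fusion

variable (C : Type u) [Category.{v} C] [Abelian C] [MonoidalCategory C]

attribute [local instance] Abelian.hasFiniteBiproducts

/-- A `ℂ`-linear abelian rigid monoidal category with bilinear tensor product is a fusion category
if it is semisimple with finitely many simple objects up to isomorphism, has finite-dimensional
spaces of morphisms and a simple unit. -/
class IsFusionCategory [Linear ℂ C] [MonoidalPreadditive C] [MonoidalLinear ℂ C]
    [RigidCategory C] : Prop where
  semisimple : ∀ X : C, ∃ (n : ℕ) (S : Fin n → C), (∀ i, Simple (S i)) ∧ Nonempty (X ≅ ⨁ S)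
  finite_hom : ∀ X Y : C, FiniteDimensional ℂ (X ⟶ Y)
  finite_simples : ∃ (n : ℕ) (S : Fin n → C), ∀ X : C, Simple X → ∃ i, Nonempty (X ≅ S i)
  simple_unit : Simple (𝟙_ C)

/-- Isomorphism, as an equivalence relation on simple objects. -/
def simpleSetoid : Setoid {X : C // Simple X} where
  r X Y := Nonempty (X.1 ≅ Y.1)
  iseqv :=
    { refl := fun X => ⟨Iso.refl X.1⟩
      symm := fun ⟨e⟩ => ⟨e.symm⟩
      trans := fun ⟨e⟩ ⟨e'⟩ => ⟨e ≪≫ e'⟩ }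

/-- The set of isomorphism classes of simple objects. -/
def Irr : Type u := Quotient (simpleSetoid C)

variable {C}

/-- An object is invertible if it has an inverse for the tensor product. -/
def IsInvertibleObj (X : C) : Prop :=
  ∃ Y : C, Nonempty (X ⊗ Y ≅ 𝟙_ C) ∧ Nonempty (Y ⊗ X ≅ 𝟙_ C)

variable (C)

/-- A pointed category: all simple objects are invertible. -/
def IsPointed : Prop := ∀ X : C, Simple X → IsInvertibleObj X

variable {C}

/-- `d` is the Frobenius-Perron dimension function: a ring homomorphism from the Grothendieck ring
to `ℝ` (written as a function on objects), positive on simple objects. -/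
structure IsFPDimFunction (d : C → ℝ) : Prop where
  iso : ∀ X Y : C, Nonempty (X ≅ Y) → d X = d Y
  biprod : ∀ X Y : C, d (X ⊞ Y) = d X + d Y
  unit : d (𝟙_ C) = 1
  tensor : ∀ X Y : C, d (X ⊗ Y) = d X * d Y
  pos : ∀ X : C, Simple X → 0 < d X

variable (C)

/-- The Frobenius-Perron dimension of the category is `r`. -/
def HasFPDim (r : ℝ) : Prop :=
  ∃ d : C → ℝ, IsFPDimFunction d ∧ ∑ᶠ x : Irr C, d (Quotient.out x).1 ^ 2 = r

/-- An Ising category: non-pointed of Frobenius-Perron dimension four (used for fusion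
categories). -/
def IsIsing : Prop := ¬ IsPointed C ∧ HasFPDim C 4

end Fusion

/-! ## The monoidal category of tensor autoequivalences -/

section TensorAut

variable (D : Type u) [Category.{v} D] [Preadditive D] [Linear ℂ D] [MonoidalCategory D]

/-- A tensor autoequivalence: a `ℂ`-linear (strong) monoidal self-equivalence. -/
structure TensorAut where
  F : D ⥤ D
  [monoidal : F.Monoidal]
  [additive : F.Additive]
  [linear : F.Linear ℂ]
  [isEquivalence : F.IsEquivalence]

namespace TensorAut

attribute [instance] monoidal additive linear isEquivalence

variable {D}

/-- Tensor natural isomorphisms. -/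
@[ext]
structure Hom (F G : TensorAut D) where
  iso : F.F ≅ G.F
  isMonoidal : NatTrans.IsMonoidal iso.hom

attribute [instance] Hom.isMonoidal

instance : Category (TensorAut D) where
  Hom := Hom
  id F := ⟨Iso.refl F.F, NatTrans.IsMonoidal.id⟩
  comp a b := ⟨a.iso ≪≫ b.iso, NatTrans.IsMonoidal.comp a.iso.hom b.iso.hom⟩

/-- The component at `X` of a tensor natural isomorphism. -/
def Hom.app {F G : TensorAut D} (a : F ⟶ G) (X : D) : F.F.obj X ⟶ G.F.obj X :=
  (Hom.iso a).hom.app X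

theorem hom_ext {F G : TensorAut D} {a b : F ⟶ G} (h : ∀ X, Hom.app a X = Hom.app b X) :
    a = b := by
  apply Hom.ext
  ext X
  exact h X

@[simp] theorem id_app (F : TensorAut D) (X : D) : Hom.app (𝟙 F) X = 𝟙 _ := rfl

@[simp] theorem comp_app {F G H : TensorAut D} (a : F ⟶ G) (b : G ⟶ H) (X : D) :
    Hom.app (a ≫ b) X = Hom.app a X ≫ Hom.app b X := rfl

theorem app_naturality {F G : TensorAut D} (a : F ⟶ G) {X Y : D} (p : X ⟶ Y) :
    F.F.map p ≫ Hom.app a Y = Hom.app a X ≫ G.F.map p := (Hom.iso a).hom.naturality p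

/-- An isomorphism from a tensor natural isomorphism. -/
def mkIso {F G : TensorAut D} (e : F.F ≅ G.F) [NatTrans.IsMonoidal e.hom] : F ≅ G where
  hom := ⟨e, inferInstance⟩
  inv := ⟨e.symm, inferInstanceAs (NatTrans.IsMonoidal e.inv)⟩
  hom_inv_id := hom_ext fun X => e.hom_inv_id_app X
  inv_hom_id := hom_ext fun X => e.inv_hom_id_app X

/-- The tensor product of `F` and `G` is the composite `F ∘ G`. -/
instance : MonoidalCategoryStruct (TensorAut D) where
  tensorObj F G := { F := G.F ⋙ F.F }
  tensorUnit := { F := 𝟭 D }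
  whiskerLeft F _ _ b :=
    ⟨Functor.isoWhiskerRight b.iso F.F,
      inferInstanceAs (NatTrans.IsMonoidal (Functor.whiskerRight b.iso.hom F.F))⟩
  whiskerRight a G :=
    ⟨Functor.isoWhiskerLeft G.F a.iso,
      inferInstanceAs (NatTrans.IsMonoidal (Functor.whiskerLeft G.F a.iso.hom))⟩
  tensorHom a b :=
    ⟨NatIso.hcomp b.iso a.iso,
      inferInstanceAs (NatTrans.IsMonoidal (b.iso.hom ◫ a.iso.hom))⟩
  associator F G H :=
    haveI : NatTrans.IsMonoidal (Functor.associator H.F G.F F.F).symm.hom :=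
      inferInstanceAs (NatTrans.IsMonoidal (Functor.associator H.F G.F F.F).inv)
    mkIso (Functor.associator H.F G.F F.F).symm
  leftUnitor F := mkIso F.F.rightUnitor
  rightUnitor F := mkIso F.F.leftUnitor


@[simp] theorem whiskerLeft_app (F : TensorAut D) {G H : TensorAut D} (b : G ⟶ H) (X : D) :
    Hom.app (F ◁ b) X = F.F.map (Hom.app b X) := rfl

@[simp] theorem whiskerRight_app {F G : TensorAut D} (a : F ⟶ G) (H : TensorAut D) (X : D) :
    Hom.app (a ▷ H) X = Hom.app a (H.F.obj X) := rfl

theorem tensorHom_app {F F' G G' : TensorAut D} (a : F ⟶ F') (b : G ⟶ G') (X : D) :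
    Hom.app (a ⊗ₘ b) X = F.F.map (Hom.app b X) ≫ Hom.app a (G'.F.obj X) :=
  (app_naturality a (Hom.app b X)).symm

@[simp] theorem associator_hom_app (F G H : TensorAut D) (X : D) :
    Hom.app (α_ F G H).hom X = 𝟙 (F.F.obj (G.F.obj (H.F.obj X))) := rfl

@[simp] theorem associator_inv_app (F G H : TensorAut D) (X : D) :
    Hom.app (α_ F G H).inv X = 𝟙 (F.F.obj (G.F.obj (H.F.obj X))) := rfl

@[simp] theorem leftUnitor_hom_app (F : TensorAut D) (X : D) :
    Hom.app (λ_ F).hom X = 𝟙 (F.F.obj X) := rfl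

@[simp] theorem leftUnitor_inv_app (F : TensorAut D) (X : D) :
    Hom.app (λ_ F).inv X = 𝟙 (F.F.obj X) := rfl

@[simp] theorem rightUnitor_hom_app (F : TensorAut D) (X : D) :
    Hom.app (ρ_ F).hom X = 𝟙 (F.F.obj X) := rfl

@[simp] theorem rightUnitor_inv_app (F : TensorAut D) (X : D) :
    Hom.app (ρ_ F).inv X = 𝟙 (F.F.obj X) := rfl

instance : MonoidalCategory (TensorAut D) :=
  MonoidalCategory.ofTensorHom
    (id_tensorHom_id := fun F G => hom_ext fun X => by
      rw [tensorHom_app]; exact (Category.comp_id _).trans (F.F.map_id _))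
    (id_tensorHom := fun F _ _ b => hom_ext fun X => by
      rw [tensorHom_app]; exact Category.comp_id _)
    (tensorHom_id := fun {F _} a G => hom_ext fun X => by
      rw [tensorHom_app]; erw [F.F.map_id]; exact Category.id_comp _)
    (tensorHom_comp_tensorHom := fun {F₁ G₁ F₂ G₂ F₃ G₃} a₁ a₂ b₁ b₂ => hom_ext fun X => by
      simp only [comp_app, tensorHom_app, Functor.map_comp, Category.assoc]
      rw [← Category.assoc (Hom.app a₁ _), ← app_naturality, Category.assoc])
    (associator_naturality := fun {F₁ F₂ F₃ G₁ G₂ G₃} a₁ a₂ a₃ => hom_ext fun X => by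
      simp only [comp_app, tensorHom_app, associator_hom_app]
      erw [Category.comp_id, Category.id_comp]
      simp only [Functor.map_comp, Category.assoc]
      rfl)
    (leftUnitor_naturality := fun {F G} a => hom_ext fun X => by
      simp only [comp_app, tensorHom_app, leftUnitor_hom_app]
      erw [Category.comp_id, Category.id_comp, Category.comp_id]
      rfl)
    (rightUnitor_naturality := fun {F G} a => hom_ext fun X => by
      simp only [comp_app, tensorHom_app, rightUnitor_hom_app]
      erw [Category.comp_id, Category.id_comp, F.F.map_id]
      exact Category.id_comp _)
    (pentagon := fun F G H K => hom_ext fun X => by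
      simp only [comp_app, tensorHom_app, associator_hom_app, id_app]
      erw [Category.comp_id, Category.id_comp, F.F.map_id, CategoryTheory.Functor.map_id]
      exact Category.id_comp _)
    (triangle := fun F G => hom_ext fun X => by
      simp only [comp_app, tensorHom_app, associator_hom_app, id_app, leftUnitor_hom_app,
        rightUnitor_hom_app]
      erw [Category.id_comp]
      rfl)

end TensorAut
end TensorAut

/-! ## Fermions and fermionic autoequivalences -/

section Fermion

variable (C : Type u) [Category.{v} C] [Preadditive C] [MonoidalCategory C]

/-- A fermion in `C`: an object `(f, σ)` of the Drinfeld center with `f ⊗ f ≅ 1` and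
`σ_{f,f} = -id`. Mathlib's half-braidings go `f ⊗ V ⟶ V ⊗ f`; `σ_{V,f} : V ⊗ f ⟶ f ⊗ V`
is the inverse. -/
structure Fermion where
  obj : Center C
  square : Nonempty (obj ⊗ obj ≅ 𝟙_ (Center C))
  self : (obj.2.β obj.1).inv = -𝟙 (obj.1 ⊗ obj.1)

namespace Fermion

variable {C} (f : Fermion C)

/-- The underlying object of a fermion. -/
def X : C := f.obj.1

/-- The half-braiding `σ_{V,f} : V ⊗ f ≅ f ⊗ V`. -/
def σ (V : C) : V ⊗ f.X ≅ f.X ⊗ V := (f.obj.2.β V).symm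

theorem σ_naturality {V W : C} (p : V ⟶ W) :
    p ▷ f.X ≫ (f.σ W).hom = (f.σ V).hom ≫ f.X ◁ p := by
  have h := f.obj.2.naturality p
  change p ▷ f.obj.1 ≫ (f.obj.2.β W).inv = (f.obj.2.β V).inv ≫ f.obj.1 ◁ p
  rw [Iso.comp_inv_eq, Category.assoc, h, Iso.inv_hom_id_assoc]

/-- A braided category with a fermion of the form `(f, c_{-,f})`. -/
def IsSpinBraided [BraidedCategory C] : Prop := ∀ V : C, f.σ V = β_ V f.X

open Functor.LaxMonoidal Functor.OplaxMonoidal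

/-- A monoidal functor `F` is fermionic if there is an isomorphism `φ : F f ≅ f` compatible with
the half-braidings. -/
def IsFermionicFunctor (F : C ⥤ C) [F.Monoidal] : Prop :=
  ∃ φ : F.obj f.X ≅ f.X, ∀ V : C,
    F.map (f.σ V).hom ≫ δ F f.X V ≫ φ.hom ▷ F.obj V =
      δ F V f.X ≫ F.obj V ◁ φ.hom ≫ (f.σ (F.obj V)).hom

theorem isFermionicFunctor_id : f.IsFermionicFunctor (𝟭 C) :=
  ⟨Iso.refl _, fun V => by simp⟩

theorem IsFermionicFunctor.comp {F G : C ⥤ C} [F.Monoidal] [G.Monoidal]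
    (hG : f.IsFermionicFunctor G) (hF : f.IsFermionicFunctor F) :
    f.IsFermionicFunctor (G ⋙ F) := by
  obtain ⟨ψ, hψ⟩ := hG
  obtain ⟨φ, hφ⟩ := hF
  refine ⟨F.mapIso ψ ≪≫ φ, fun V => ?_⟩
  have h1 := congrArg (fun t => F.map t) (hψ V)
  simp only [Functor.map_comp] at h1
  have h2 := hφ (G.obj V)
  have e1 : F.map (ψ.hom ▷ G.obj V) ≫ δ F f.X (G.obj V) =
      δ F (G.obj f.X) (G.obj V) ≫ F.map ψ.hom ▷ F.obj (G.obj V) := by simp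
  have e2 : F.map (G.obj V ◁ ψ.hom) ≫ δ F (G.obj V) f.X =
      δ F (G.obj V) (G.obj f.X) ≫ F.obj (G.obj V) ◁ F.map ψ.hom := by simp
  simp only [Functor.comp_obj, Functor.comp_map, Functor.OplaxMonoidal.comp_δ, Iso.trans_hom,
    Functor.mapIso_hom, comp_whiskerRight, MonoidalCategory.whiskerLeft_comp, Category.assoc]
  rw [← reassoc_of% e1, reassoc_of% h1, h2, reassoc_of% e2]

section

variable [Linear ℂ C]

/-- The fermionic tensor autoequivalences, as a full subcategory of the tensor
autoequivalences. -/
def fermionic : ObjectProperty (TensorAut C) := fun F => f.IsFermionicFunctor F.F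

instance : f.fermionic.IsMonoidal where
  prop_unit := f.isFermionicFunctor_id
  prop_tensor _ _ hF hG := IsFermionicFunctor.comp f hG hF

/-- The monoidal category of fermionic tensor autoequivalences of `(C, f)`. -/
abbrev FermionicAut := f.fermionic.FullSubcategory

end

end Fermion
end Fermion

/-! ## The fusion subcategory generated by a fermion and the restriction functor -/

section Restriction

variable {C : Type u} [Category.{v} C] [Abelian C] [MonoidalCategory C]

namespace Fermion

variable (f : Fermion C)

/-- The objects of the fusion subcategory `⟨f⟩` generated by `f`: the smallest class of objects
containing `1` and `f` and closed under tensor products, direct sums and direct summands. -/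
inductive gen : ObjectProperty C
  | unit : gen (𝟙_ C)
  | fermion : gen f.X
  | tensor (X Y : C) : gen X → gen Y → gen (X ⊗ Y)
  | biprod (X Y : C) : gen X → gen Y → gen (X ⊞ Y)
  | retract (X Y : C) : Retract X Y → gen Y → gen X

instance : f.gen.IsMonoidal where
  prop_unit := gen.unit
  prop_tensor X Y hX hY := gen.tensor X Y hX hY

theorem gen_of_iso {X Y : C} (e : X ≅ Y) (h : f.gen X) : f.gen Y :=
  gen.retract Y X (Retract.ofIso e.symm) h

/-- The fusion subcategory generated by `f`. -/
abbrev Gen := f.gen.FullSubcategory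

/-- The fermion as an object of `⟨f⟩`. -/
def genObj : f.Gen := ⟨f.X, gen.fermion⟩

open Functor.LaxMonoidal Functor.OplaxMonoidal

theorem gen_map (F : C ⥤ C) [F.Monoidal] [F.Additive] (φ : F.obj f.X ≅ f.X) {X : C}
    (h : f.gen X) : f.gen (F.obj X) := by
  induction h with
  | unit => exact f.gen_of_iso (Functor.Monoidal.εIso F) gen.unit
  | fermion => exact f.gen_of_iso φ.symm gen.fermion
  | tensor X Y _ _ hX hY =>
    exact f.gen_of_iso (Functor.Monoidal.μIso F X Y) (gen.tensor _ _ hX hY)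
  | biprod X Y _ _ hX hY =>
    have := preservesBinaryBiproducts_of_preservesBiproducts F
    exact f.gen_of_iso (F.mapBiprod X Y).symm (gen.biprod _ _ hX hY)
  | retract X Y r _ hY => exact gen.retract _ _ (r.map F) hY


theorem gen_preimage (F : C ⥤ C) [F.Monoidal] [F.Additive] [F.IsEquivalence]
    (φ : F.obj f.X ≅ f.X) {X : C} (h : f.gen X) : ∃ Y, f.gen Y ∧ Nonempty (F.obj Y ≅ X) := by
  have := preservesBinaryBiproducts_of_preservesBiproducts F
  induction h with
  | unit => exact ⟨_, gen.unit, ⟨(Functor.Monoidal.εIso F).symm⟩⟩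
  | fermion => exact ⟨_, gen.fermion, ⟨φ⟩⟩
  | tensor X Y _ _ hX hY =>
    obtain ⟨X', hX', ⟨e⟩⟩ := hX
    obtain ⟨Y', hY', ⟨e'⟩⟩ := hY
    exact ⟨_, gen.tensor _ _ hX' hY', ⟨(Functor.Monoidal.μIso F X' Y').symm ≪≫ (e ⊗ᵢ e')⟩⟩
  | biprod X Y _ _ hX hY =>
    obtain ⟨X', hX', ⟨e⟩⟩ := hX
    obtain ⟨Y', hY', ⟨e'⟩⟩ := hY
    exact ⟨_, gen.biprod _ _ hX' hY', ⟨F.mapBiprod X' Y' ≪≫ biprod.mapIso e e'⟩⟩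
  | retract X Y r _ hY =>
    obtain ⟨Y', hY', ⟨e⟩⟩ := hY
    let e₀ := F.objObjPreimageIso X
    refine ⟨F.objPreimage X, gen.retract _ _ ?_ hY', ⟨e₀⟩⟩
    exact
      { i := F.preimage (e₀.hom ≫ r.i ≫ e.inv)
        r := F.preimage (e.hom ≫ r.r ≫ e₀.inv)
        retract := F.map_injective (by simp) }

section

variable [Linear ℂ C]

/-- The restriction of a fermionic tensor autoequivalence to `⟨f⟩`. -/
def restrictFunctor (F : f.FermionicAut) : f.Gen ⥤ f.Gen :=
  f.gen.lift (f.gen.ι ⋙ F.obj.F) fun X => f.gen_map F.obj.F F.property.choose X.property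

theorem restrict_map_hom (F : f.FermionicAut) {X Y : f.Gen} (p : X ⟶ Y) :
    ((f.restrictFunctor F).map p).hom = F.obj.F.map p.hom := rfl

instance (F : f.FermionicAut) : (f.restrictFunctor F).Monoidal :=
  Functor.CoreMonoidal.toMonoidal
    { εIso := f.gen.isoMk (Functor.Monoidal.εIso F.obj.F)
      μIso := fun X Y => f.gen.isoMk (Functor.Monoidal.μIso F.obj.F X.obj Y.obj)
      μIso_hom_natural_left := fun p X' => ObjectProperty.hom_ext _
        (μ_natural_left F.obj.F p.hom X'.obj)
      μIso_hom_natural_right := fun X' p => ObjectProperty.hom_ext _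
        (μ_natural_right F.obj.F X'.obj p.hom)
      associativity := fun X Y Z => ObjectProperty.hom_ext _
        (associativity F.obj.F X.obj Y.obj Z.obj)
      left_unitality := fun X => ObjectProperty.hom_ext _
        (left_unitality F.obj.F X.obj)
      right_unitality := fun X => ObjectProperty.hom_ext _
        (right_unitality F.obj.F X.obj) }

theorem restrict_ε_hom (F : f.FermionicAut) :
    (ε (f.restrictFunctor F)).hom = ε F.obj.F := rfl

theorem restrict_μ_hom (F : f.FermionicAut) (X Y : f.Gen) :
    (μ (f.restrictFunctor F) X Y).hom = μ F.obj.F X.obj Y.obj := rfl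

instance (F : f.FermionicAut) : (f.restrictFunctor F).Additive where
  map_add {_ _ p q} := ObjectProperty.hom_ext _ (F.obj.F.map_add (f := p.hom) (g := q.hom))

instance (F : f.FermionicAut) : (f.restrictFunctor F).Linear ℂ where
  map_smul p r := ObjectProperty.hom_ext _ (F.obj.F.map_smul r p.hom)

instance (F : f.FermionicAut) : (f.restrictFunctor F).IsEquivalence where
  faithful := ⟨fun {_ _ p q} h => ObjectProperty.hom_ext _ (F.obj.F.map_injective (by
    have h' := congrArg InducedCategory.Hom.hom h
    exact h'))⟩
  full := ⟨fun p => ⟨ObjectProperty.homMk (F.obj.F.preimage p.hom),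
    ObjectProperty.hom_ext _ (F.obj.F.map_preimage p.hom)⟩⟩
  essSurj := ⟨fun X => by
    obtain ⟨Y, hY, ⟨e⟩⟩ := f.gen_preimage F.obj.F F.property.choose X.property
    exact ⟨⟨Y, hY⟩, ⟨f.gen.isoMk e⟩⟩⟩

/-- The restriction of a tensor natural isomorphism to `⟨f⟩`. -/
def restrictIso {F G : f.FermionicAut} (a : F ⟶ G) : f.restrictFunctor F ≅ f.restrictFunctor G :=
  NatIso.ofComponents (fun X => f.gen.isoMk (a.hom.iso.app X.obj))
    fun p => ObjectProperty.hom_ext _ (a.hom.iso.hom.naturality p.hom)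

instance {F G : f.FermionicAut} (a : F ⟶ G) : NatTrans.IsMonoidal (f.restrictIso a).hom where
  unit := ObjectProperty.hom_ext _ (NatTrans.IsMonoidal.unit (τ := a.hom.iso.hom))
  tensor X Y := ObjectProperty.hom_ext _
    (NatTrans.IsMonoidal.tensor (τ := a.hom.iso.hom) X.obj Y.obj)

/-- The restriction functor from fermionic tensor autoequivalences of `C` to tensor
autoequivalences of `⟨f⟩`. -/
def rest : f.FermionicAut ⥤ TensorAut f.Gen where
  obj F := { F := f.restrictFunctor F }
  map a := ⟨f.restrictIso a, inferInstance⟩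
  map_id _ := TensorAut.hom_ext fun _ => rfl
  map_comp _ _ := TensorAut.hom_ext fun _ => rfl

/-- Restriction preserves the identity functor. -/
def restUnitIso : 𝟭 f.Gen ≅ f.restrictFunctor (𝟙_ f.FermionicAut) :=
  NatIso.ofComponents (fun X => f.gen.isoMk (Iso.refl X.obj))
    fun p => ObjectProperty.hom_ext _ ((Category.comp_id p.hom).trans (Category.id_comp p.hom).symm)

theorem restUnitIso_isMonoidal : NatTrans.IsMonoidal f.restUnitIso.hom where
  unit := ObjectProperty.hom_ext _ (Category.comp_id (𝟙 (𝟙_ C)))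
  tensor X Y := ObjectProperty.hom_ext _ (by
    change 𝟙 (X.obj ⊗ Y.obj) ≫ 𝟙 (X.obj ⊗ Y.obj) =
      (𝟙 X.obj ⊗ₘ 𝟙 Y.obj) ≫ 𝟙 (X.obj ⊗ Y.obj)
    simp)

/-- Restriction preserves composition. -/
def restTensorIso (F G : f.FermionicAut) :
    f.restrictFunctor G ⋙ f.restrictFunctor F ≅ f.restrictFunctor (F ⊗ G) :=
  NatIso.ofComponents (fun X => f.gen.isoMk (Iso.refl (F.obj.F.obj (G.obj.F.obj X.obj))))
    fun p => ObjectProperty.hom_ext _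
      ((Category.comp_id (F.obj.F.map (G.obj.F.map p.hom))).trans (Category.id_comp _).symm)

theorem restTensorIso_isMonoidal (F G : f.FermionicAut) :
    NatTrans.IsMonoidal (f.restTensorIso F G).hom where
  unit := ObjectProperty.hom_ext _
    (Category.comp_id (ε F.obj.F ≫ F.obj.F.map (ε G.obj.F)))
  tensor X Y := ObjectProperty.hom_ext _ (by
    change (μ F.obj.F _ _ ≫ F.obj.F.map (μ G.obj.F X.obj Y.obj)) ≫ 𝟙 _ =
      (𝟙 (F.obj.F.obj (G.obj.F.obj X.obj)) ⊗ₘ 𝟙 (F.obj.F.obj (G.obj.F.obj Y.obj))) ≫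
        (μ F.obj.F _ _ ≫ F.obj.F.map (μ G.obj.F X.obj Y.obj))
    simp)

instance : f.rest.Monoidal :=
  Functor.CoreMonoidal.toMonoidal
    { εIso := @TensorAut.mkIso _ _ _ _ _ _ _ f.restUnitIso f.restUnitIso_isMonoidal
      μIso := fun F G => @TensorAut.mkIso _ _ _ _ _ _ _ (f.restTensorIso F G)
        (f.restTensorIso_isMonoidal F G)
      μIso_hom_natural_left := fun {F G} a H => TensorAut.hom_ext fun X =>
        ObjectProperty.hom_ext _
          ((Category.comp_id (a.hom.app (H.obj.F.obj X.obj))).trans (Category.id_comp _).symm)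
      μIso_hom_natural_right := fun {F G} H a => TensorAut.hom_ext fun X =>
        ObjectProperty.hom_ext _
          ((Category.comp_id (H.obj.F.map (a.hom.app X.obj))).trans (Category.id_comp _).symm)
      associativity := fun F G H => TensorAut.hom_ext fun X => ObjectProperty.hom_ext _ (by
        change 𝟙 (F.obj.F.obj (G.obj.F.obj (H.obj.F.obj X.obj))) ≫ 𝟙 _ ≫ 𝟙 _ =
          𝟙 _ ≫ F.obj.F.map (𝟙 _) ≫ 𝟙 _
        simp)
      left_unitality := fun F => TensorAut.hom_ext fun X => ObjectProperty.hom_ext _ (by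
        change 𝟙 (F.obj.F.obj X.obj) = 𝟙 _ ≫ 𝟙 _ ≫ 𝟙 _
        simp)
      right_unitality := fun F => TensorAut.hom_ext fun X => ObjectProperty.hom_ext _ (by
        change 𝟙 (F.obj.F.obj X.obj) = F.obj.F.map (𝟙 _) ≫ 𝟙 _ ≫ 𝟙 _
        simp) }

end

end Fermion
end Restriction

/-! ## Super-groups and fermionic actions -/

section Action

open Functor.LaxMonoidal

/-- `H²(G, ℤ/2)` with trivial action. A finite super-group is a pair `(G, α)` of a finite group `G`
and a class `α` in it, namely the class of the central extension of `G` by `ℤ/2`. -/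
abbrev H2Z2 (G : Type) [Group G] : Type :=
  groupCohomology.H2 (Rep.trivial (ZMod 2) G (ZMod 2))

/-- Let `T` be a monoidal functor from the discrete monoidal category `G` to tensor autoequivalences
of `D`, and `X` an object of `D`. The class of `T` at `X` is `α` if there are tensor natural
isomorphisms `u g : id ⟶ T g` and a 2-cocycle `a` representing `α` such that at `X`, the composite
`id = id ∘ id ⟶ T g ∘ T h ⟶ T (g h)` is `(-1) ^ a(g,h)` times `u (g h)`. -/
def HasClassAt {D : Type u} [Category.{v} D] [Preadditive D] [Linear ℂ D] [MonoidalCategory D]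
    {G : Type} [Group G] (T : Discrete G ⥤ TensorAut D) [T.Monoidal] (X : D) (α : H2Z2 G) : Prop :=
  ∃ (a : groupCohomology.cocycles₂ (Rep.trivial (ZMod 2) G (ZMod 2)))
    (u : ∀ g : G, 𝟙_ (TensorAut D) ⟶ T.obj (Discrete.mk g)),
    groupCohomology.H2π _ a = α ∧
    ∀ g h : G,
      TensorAut.Hom.app ((λ_ (𝟙_ (TensorAut D))).inv ≫ (u g ⊗ₘ u h) ≫
        μ T (Discrete.mk g) (Discrete.mk h)) X =
      ((-1 : ℂ) ^ (ZMod.val (n := 2) (a (g, h)))) • TensorAut.Hom.app (u (g * h)) X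

variable {C : Type u} [Category.{v} C] [Abelian C] [Linear ℂ C] [MonoidalCategory C]

/-- A fermionic action of the super-group `(G, α)` on `(C, f)`: a monoidal functor from `G` to
fermionic tensor autoequivalences whose restriction to `⟨f⟩` (a copy of super-vector spaces)
corresponds to `α`. -/
structure FermionicAction (f : Fermion C) (G : Type) [Group G] (α : H2Z2 G) where
  functor : Discrete G ⥤ f.FermionicAut
  [monoidal : functor.Monoidal]
  restriction : HasClassAt (functor ⋙ f.rest) f.genObj α

namespace FermionicAction

attribute [instance] monoidal

variable {f : Fermion C} {G : Type} [Group G] {α : H2Z2 G}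

/-- The underlying action by tensor autoequivalences of `C`. -/
def bosonic (T : FermionicAction f G α) : Discrete G ⥤ TensorAut C :=
  T.functor ⋙ f.fermionic.ι

instance (T : FermionicAction f G α) : T.bosonic.Monoidal :=
  inferInstanceAs (T.functor ⋙ f.fermionic.ι).Monoidal

variable (f G α)

/-- Two fermionic actions are equivalent if there is a monoidal natural isomorphism between
them. -/
instance setoid : Setoid (FermionicAction f G α) where
  r T T' := ∃ e : T.functor ≅ T'.functor, NatTrans.IsMonoidal e.hom
  iseqv :=
    { refl := fun _ => ⟨Iso.refl _, NatTrans.IsMonoidal.id⟩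
      symm := fun ⟨e, _⟩ => ⟨e.symm, inferInstanceAs (NatTrans.IsMonoidal e.inv)⟩
      trans := fun ⟨e, _⟩ ⟨e', _⟩ => ⟨e ≪≫ e', NatTrans.IsMonoidal.comp e.hom e'.hom⟩ }

/-- Equivalence classes of fermionic actions. -/
def Classes : Type _ := Quotient (setoid f G α)

variable {f G α}

/-- The equivalence class of a fermionic action. -/
def toClass (T : FermionicAction f G α) : Classes f G α := Quotient.mk _ T

end FermionicAction
end Action

end

/-!
Why the theorem is true. Counting squares of Frobenius-Perron dimensions, `1 + 1 + 2 = 4`, shows that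
the simple objects are the unit, the fermion `x` and one non-invertible object `s`, that `s` is its
own dual, that `x ⊗ s ≅ s ≅ s ⊗ x`, and that `s ⊗ s` has no constituents besides `1` and `x`
(`isingFusion`). The fermion differs from the unit because its self-braiding is `-1`
(`Fermion.not_iso_unit`).

Let `F` be a tensor autoequivalence fixing these objects. Everything in the category is generated by
the coevaluation `1 ⟶ s ⊗ s` and an embedding `j : x ⟶ s ⊗ s`. An isomorphism `w : s ≅ F s` can be
rescaled to respect the coevaluation; it then respects the evaluation by the zigzag identity, and a
unique compatible isomorphism `x ≅ F x` is determined by `j`. The maps `x ⊗ s ⟶ s` and `s ⊗ x ⟶ s`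
are built from these, and the action of `x` on `s` shows that `x ⊗ x ≅ 1` is respected too. So `w`
extends to a tensor isomorphism `id ≅ F` (`IsingFusion.exists_monoidal_iso`). Two such isomorphisms
agree up to sign at `s`, both signs occurring, and agree exactly at `x` since `x` lies in the even
power `s ⊗ s`. Hence in the monoidal category of fermionic autoequivalences every object `F` is
isomorphic to the unit, and the isomorphisms `id ≅ F` form a torsor under `ℤ/2`
(`exists_signStructure`).

Monoidal functors from `G` to such a category are classified by `H²(G, ℤ/2)`: trivializing the
objects `T g` turns the monoidal structure into a cocycle of signs, unique up to a coboundary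
(`SignStructure.exists_hasClass`, `SignStructure.exists_iso_of_hasClass`,
`SignStructure.exists_functor`). The sign is read off at `s`, which gives the bijection. At `x` all
signs are trivial, so the restriction to the subcategory generated by the fermion has class `0`
(`hasClassAt_rest_zero`), which is the only class it can have (`HasClassAt.unique`).
-/

noncomputable section

/-! ### Semisimplicity and Frobenius-Perron dimensions -/

section Semisimple

attribute [local instance] Abelian.hasFiniteBiproducts

theorem IsFPDimFunction.zero {C : Type u} [Category.{v} C] [Abelian C] [MonoidalCategory C]
    {d : C → ℝ} (hd : IsFPDimFunction d) {X : C} (h : IsZero X) : d X = 0 := by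
  have h1 := hd.biprod X X
  have h2 := hd.iso X (X ⊞ X) ⟨h.iso ((biprod_isZero_iff X X).2 ⟨h, h⟩)⟩
  linarith

theorem IsFPDimFunction.biproduct {C : Type u} [Category.{v} C] [Abelian C] [MonoidalCategory C]
    {d : C → ℝ} (hd : IsFPDimFunction d) {n : ℕ} (S : Fin n → C) : d (⨁ S) = ∑ i, d (S i) := by
  induction n with
  | zero =>
    rw [Fin.sum_univ_zero]
    exact hd.zero ((IsZero.iff_id_eq_zero _).2 (biproduct.hom_ext _ _ fun i => i.elim0))
  | succ n ih =>
    rw [Fin.sum_univ_succ, ← ih fun i => S i.succ, ← hd.biprod]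
    refine hd.iso _ _ ⟨⟨biprod.lift (biproduct.π S 0) (biproduct.lift fun i => biproduct.π S i.succ),
      biprod.desc (biproduct.ι S 0) (biproduct.desc fun i => biproduct.ι S i.succ), ?_, ?_⟩⟩
    · rw [biprod.lift_desc, biproduct.lift_desc, ← biproduct.total, Fin.sum_univ_succ]
    · ext i
      · simp
      · simp [biproduct.ι_π_ne S (Fin.succ_ne_zero i).symm]
      · simp [biproduct.ι_π_ne S (Fin.succ_ne_zero _)]
      · rename_i j
        by_cases h : i = j
        · subst h
          simp
        · have h' : i.succ ≠ j.succ := fun e => h (Fin.succ_injective _ e)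
          simp [biproduct.ι_π_ne S h', biproduct.ι_π_ne (fun i : Fin n => S i.succ) h]

variable {C : Type u} [Category.{v} C] [Abelian C] [Linear ℂ C] [MonoidalCategory C]
    [MonoidalPreadditive C] [MonoidalLinear ℂ C] [RigidCategory C] [IsFusionCategory C]

/-- Semisimplicity in coordinates, with the dimension of the object read off from the summands. -/
theorem exists_simple_resolution (X : C) :
    ∃ (n : ℕ) (S : Fin n → C) (ι : ∀ i, S i ⟶ X) (π : ∀ i, X ⟶ S i), (∀ i, Simple (S i)) ∧
      (∀ i, ι i ≫ π i = 𝟙 _) ∧ ∑ i, π i ≫ ι i = 𝟙 X ∧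
      ∀ d : C → ℝ, IsFPDimFunction d → d X = ∑ i, d (S i) := by
  obtain ⟨n, S, hS, ⟨e⟩⟩ := IsFusionCategory.semisimple X
  refine ⟨n, S, fun i => biproduct.ι S i ≫ e.inv, fun i => e.hom ≫ biproduct.π S i, hS,
    fun i => by simp, ?_, fun d hd => by rw [hd.iso _ _ ⟨e⟩, hd.biproduct]⟩
  calc ∑ i, (e.hom ≫ biproduct.π S i) ≫ biproduct.ι S i ≫ e.inv
      = e.hom ≫ (∑ i, biproduct.π S i ≫ biproduct.ι S i) ≫ e.inv := by
        rw [Preadditive.sum_comp, Preadditive.comp_sum]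
        simp only [Category.assoc]
    _ = 𝟙 X := by rw [biproduct.total]; simp

end Semisimple

section Abelian

variable {C : Type u} [Category.{v} C] [Abelian C]

theorem simple_iso_of_ne_zero {S T : C} [Simple S] [Simple T] {a : S ⟶ T} (ha : a ≠ 0) :
    Nonempty (S ≅ T) :=
  have := isIso_of_hom_simple ha
  ⟨asIso a⟩

theorem eq_zero_of_isEmpty_iso {S T : C} [Simple S] [Simple T] (h : ¬ Nonempty (S ≅ T))
    (a : S ⟶ T) : a = 0 := by
  by_contra ha
  exact h (simple_iso_of_ne_zero ha)

theorem IsFPDimFunction.sum_sq_le [MonoidalCategory C] {d : C → ℝ}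
    (hd : IsFPDimFunction d) {r : ℝ} (hr : r ≠ 0)
    (hsum : ∑ᶠ x : Irr C, d (Quotient.out x).1 ^ 2 = r) {I : Type} [Fintype I]
    (S : I → C) (hS : ∀ i, Simple (S i)) (hne : ∀ i j, Nonempty (S i ≅ S j) → i = j) :
    ∑ i, d (S i) ^ 2 ≤ r := by
  classical
  -- A sum over infinitely many nonzero terms would be `0` by convention.
  have hfin : (Function.support fun x : Irr C => d (Quotient.out x).1 ^ 2).Finite := by
    by_contra h
    exact hr (by rw [← hsum, finsum_of_infinite_support h])
  let k : I → Irr C := fun i => Quotient.mk (simpleSetoid C) ⟨S i, hS i⟩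
  have hk : ∀ i, Nonempty ((Quotient.out (k i)).1 ≅ S i) := fun i =>
    Quotient.exact (Quotient.out_eq (k i))
  have hinj : Function.Injective k := fun i j hij =>
    hne i j (Quotient.exact hij : (simpleSetoid C).r _ _)
  rw [← hsum, finsum_eq_sum _ hfin]
  calc ∑ i, d (S i) ^ 2 = ∑ i, d (Quotient.out (k i)).1 ^ 2 :=
        Finset.sum_congr rfl fun i _ => by rw [hd.iso _ _ (hk i)]
    _ = ∑ t ∈ Finset.univ.map ⟨k, hinj⟩, d (Quotient.out t).1 ^ 2 := by rw [Finset.sum_map]; rfl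
    _ ≤ _ := Finset.sum_le_sum_of_subset_of_nonneg (fun t _ => by
        simpa using (hd.pos _ (Quotient.out t).2).ne') fun t _ _ => sq_nonneg _

end Abelian

section Schur

variable {C : Type u} [Category.{v} C] [Abelian C] [Linear ℂ C] [MonoidalCategory C]
    [MonoidalPreadditive C] [MonoidalLinear ℂ C] [RigidCategory C] [IsFusionCategory C]

theorem exists_smul_id {S : C} [Simple S] (g : S ⟶ S) : ∃ c : ℂ, g = c • 𝟙 S := by
  have := IsFusionCategory.finite_hom S S
  obtain ⟨c, hc⟩ := endomorphism_simple_eq_smul_id ℂ g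
  exact ⟨c, hc.symm⟩

theorem exists_smul_of_simple {S T : C} [Simple S] [Simple T] {a : S ⟶ T} (ha : a ≠ 0)
    (g : S ⟶ T) : ∃ c : ℂ, g = c • a := by
  have := isIso_of_hom_simple ha
  obtain ⟨c, hc⟩ := exists_smul_id (g ≫ inv a)
  refine ⟨c, ?_⟩
  have := congrArg (· ≫ a) hc
  simpa using this

/-- A converse of Schur's lemma. -/
theorem simple_of_forall_smul_id {X : C} (h0 : 𝟙 X ≠ 0) (h : ∀ g : X ⟶ X, ∃ c : ℂ, g = c • 𝟙 X) :
    Simple X := by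
  obtain ⟨n, S, ι, π, hS, hιπ, ht, -⟩ := exists_simple_resolution X
  rcases Nat.eq_zero_or_pos n with rfl | hn
  · exact absurd (by simpa using ht.symm) h0
  · let i : Fin n := ⟨0, hn⟩
    have := hS i
    obtain ⟨c, hc⟩ := h (π i ≫ ι i)
    have hc0 : c ≠ 0 := by
      rintro rfl
      have h1 : ι i ≫ (π i ≫ ι i) ≫ π i = 𝟙 (S i) := by simp [hιπ]
      rw [hc] at h1
      exact id_nonzero (S i) (by simpa using h1.symm)
    have hinv : π i ≫ (c⁻¹ • ι i) = 𝟙 X := by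
      rw [Linear.comp_smul, hc, smul_smul, inv_mul_cancel₀ hc0, one_smul]
    have hc1 : c • 𝟙 (S i) = 𝟙 (S i) := by
      have : ι i ≫ (π i ≫ ι i) ≫ π i = c • 𝟙 (S i) := by rw [hc]; simp [hιπ]
      rw [← this]; simp [hιπ]
    have hc2 : c⁻¹ • 𝟙 (S i) = 𝟙 (S i) := by
      nth_rewrite 1 [← hc1]
      rw [smul_smul, inv_mul_cancel₀ hc0, one_smul]
    exact Simple.of_iso ⟨π i, c⁻¹ • ι i, hinv, by rw [Linear.smul_comp, hιπ, hc2]⟩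

/-- Pairwise non-isomorphic simple objects mapping nontrivially to `X` are distinct constituents
of `X`, so their dimensions add up to at most that of `X`. -/
theorem IsFPDimFunction.sum_le {d : C → ℝ} (hd : IsFPDimFunction d) {I : Type} [Fintype I]
    (S : I → C) (hS : ∀ i, Simple (S i)) (hne : ∀ i j, Nonempty (S i ≅ S j) → i = j) (X : C)
    (a : ∀ i, S i ⟶ X) (ha : ∀ i, a i ≠ 0) : ∑ i, d (S i) ≤ d X := by
  classical
  obtain ⟨n, T, ι, π, hT, -, ht, hdX⟩ := exists_simple_resolution X
  have hex : ∀ i, ∃ k, Nonempty (S i ≅ T k) := fun i => by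
    by_contra! hcon
    refine ha i ?_
    rw [← Category.comp_id (a i), ← ht, Preadditive.comp_sum]
    refine Finset.sum_eq_zero fun k _ => ?_
    have := hS i
    have := hT k
    rw [← Category.assoc, eq_zero_of_isEmpty_iso (not_nonempty_iff.2 (hcon k)) (a i ≫ π k),
      zero_comp]
  choose k hk using hex
  have hinj : Function.Injective k := fun i j hij => by
    obtain ⟨e⟩ := hk i
    obtain ⟨e'⟩ := hk j
    exact hne i j ⟨e ≪≫ eqToIso (congrArg T hij) ≪≫ e'.symm⟩
  calc ∑ i, d (S i) = ∑ i, d (T (k i)) := Finset.sum_congr rfl fun i _ => hd.iso _ _ (hk i)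
    _ = ∑ t ∈ Finset.univ.map ⟨k, hinj⟩, d (T t) := by rw [Finset.sum_map]; rfl
    _ ≤ ∑ t, d (T t) := Finset.sum_le_univ_sum_of_nonneg fun t => (hd.pos _ (hT t)).le
    _ = d X := (hdX d hd).symm

end Schur

/-! ### Invertible objects and duals -/

section Invertible

variable {C : Type u} [Category.{v} C] [MonoidalCategory C]

theorem IsInvertibleObj.of_iso {X Y : C} (e : X ≅ Y) (h : IsInvertibleObj X) :
    IsInvertibleObj Y := by
  obtain ⟨Z, ⟨p⟩, ⟨q⟩⟩ := h
  exact ⟨Z, ⟨whiskerRightIso e.symm Z ≪≫ p⟩, ⟨whiskerLeftIso Z e.symm ≪≫ q⟩⟩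

theorem isInvertibleObj_unit : IsInvertibleObj (𝟙_ C) := ⟨𝟙_ C, ⟨λ_ _⟩, ⟨λ_ _⟩⟩

theorem isInvertibleObj_of_square {X : C} (h : Nonempty (X ⊗ X ≅ 𝟙_ C)) : IsInvertibleObj X :=
  ⟨X, h, h⟩

theorem IsInvertibleObj.tensorLeft_isEquivalence {X : C} (h : IsInvertibleObj X) :
    (tensorLeft X).IsEquivalence := by
  obtain ⟨Y, ⟨p⟩, ⟨q⟩⟩ := h
  exact (CategoryTheory.Equivalence.mk (tensorLeft X) (tensorLeft Y)
    ((leftUnitorNatIso C).symm ≪≫ (tensoringLeft C).mapIso q.symm ≪≫ tensorLeftTensor Y X)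
    ((tensorLeftTensor X Y).symm ≪≫ (tensoringLeft C).mapIso p ≪≫
      leftUnitorNatIso C)).isEquivalence_functor

/-- In a braided category a tensor factor of an invertible object is invertible. -/
theorem IsInvertibleObj.of_tensor_left [BraidedCategory C] {X Y : C}
    (hXY : IsInvertibleObj (X ⊗ Y)) : IsInvertibleObj Y := by
  obtain ⟨Z, ⟨p⟩, -⟩ := hXY
  have e : Y ⊗ (X ⊗ Z) ≅ 𝟙_ C := (α_ _ _ _).symm ≪≫ whiskerRightIso (β_ Y X) Z ≪≫ p
  exact ⟨X ⊗ Z, ⟨e⟩, ⟨β_ _ _ ≪≫ e⟩⟩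

theorem IsInvertibleObj.simple_tensor [Preadditive C] {X Y : C} (hX : IsInvertibleObj X)
    [Simple Y] : Simple (X ⊗ Y) :=
  have := hX.tensorLeft_isEquivalence
  simple_obj (tensorLeft X) Y

variable [Preadditive C] [Linear ℂ C] [MonoidalPreadditive C] [MonoidalLinear ℂ C]

theorem tensorLeftHomEquiv_smul (X Y Y' Z : C) [ExactPairing Y Y'] (c : ℂ) (g : Y' ⊗ X ⟶ Z) :
    tensorLeftHomEquiv X Y Y' Z (c • g) = c • tensorLeftHomEquiv X Y Y' Z g := by
  simp [tensorLeftHomEquiv]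

theorem tensorRightHomEquiv_smul (X Y Y' Z : C) [ExactPairing Y Y'] (c : ℂ) (g : X ⊗ Y ⟶ Z) :
    tensorRightHomEquiv X Y Y' Z (c • g) = c • tensorRightHomEquiv X Y Y' Z g := by
  simp [tensorRightHomEquiv]

theorem tensorLeftHomEquiv_symm_smul (X Y Y' Z : C) [ExactPairing Y Y'] (c : ℂ) (g : X ⟶ Y ⊗ Z) :
    (tensorLeftHomEquiv X Y Y' Z).symm (c • g) = c • (tensorLeftHomEquiv X Y Y' Z).symm g := by
  rw [Equiv.symm_apply_eq, tensorLeftHomEquiv_smul, Equiv.apply_symm_apply]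

theorem tensorRightHomEquiv_symm_smul (X Y Y' Z : C) [ExactPairing Y Y'] (c : ℂ)
    (g : X ⟶ Z ⊗ Y') :
    (tensorRightHomEquiv X Y Y' Z).symm (c • g) = c • (tensorRightHomEquiv X Y Y' Z).symm g := by
  rw [Equiv.symm_apply_eq, tensorRightHomEquiv_smul, Equiv.apply_symm_apply]

theorem tensorLeftHomEquiv_ne_zero {X Y Y' Z : C} [ExactPairing Y Y'] {g : Y' ⊗ X ⟶ Z}
    (hg : g ≠ 0) : tensorLeftHomEquiv X Y Y' Z g ≠ 0 := fun h => hg (by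
  rw [← Equiv.eq_symm_apply] at h
  rw [h, ← zero_smul ℂ (0 : X ⟶ Y ⊗ Z), tensorLeftHomEquiv_symm_smul, zero_smul])

theorem tensorLeftHomEquiv_symm_ne_zero {X Y Y' Z : C} [ExactPairing Y Y'] {g : X ⟶ Y ⊗ Z}
    (hg : g ≠ 0) : (tensorLeftHomEquiv X Y Y' Z).symm g ≠ 0 := fun h => hg (by
  rw [Equiv.symm_apply_eq] at h
  rw [h, ← zero_smul ℂ (0 : Y' ⊗ X ⟶ Z), tensorLeftHomEquiv_smul, zero_smul])

theorem tensorRightHomEquiv_symm_ne_zero {X Y Y' Z : C} [ExactPairing Y Y'] {g : X ⟶ Z ⊗ Y'}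
    (hg : g ≠ 0) : (tensorRightHomEquiv X Y Y' Z).symm g ≠ 0 := fun h => hg (by
  rw [Equiv.symm_apply_eq] at h
  rw [h, ← zero_smul ℂ (0 : X ⊗ Y ⟶ Z), tensorRightHomEquiv_smul, zero_smul])

end Invertible

section Dual

theorem coevaluation_ne_zero {C : Type u} [Category.{v} C] [Preadditive C] [MonoidalCategory C]
    [MonoidalPreadditive C] {X Y : C} [ExactPairing X Y] [Simple X] : η_ X Y ≠ 0 := by
  intro h
  have hz := ExactPairing.evaluation_coevaluation X Y
  rw [h] at hz
  have : (λ_ X).hom ≫ (ρ_ X).inv = 0 := by rw [← hz]; simp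
  refine id_nonzero X ?_
  calc 𝟙 X = (λ_ X).inv ≫ ((λ_ X).hom ≫ (ρ_ X).inv) ≫ (ρ_ X).hom := by simp
    _ = 0 := by rw [this]; simp

theorem IsFPDimFunction.eq_one_of_square {C : Type u} [Category.{v} C] [Abelian C]
    [MonoidalCategory C] {d : C → ℝ} (hd : IsFPDimFunction d) {x : C}
    [Simple x] (hx : Nonempty (x ⊗ x ≅ 𝟙_ C)) : d x = 1 := by
  have h1 := hd.iso _ _ hx
  rw [hd.tensor, hd.unit] at h1
  nlinarith [hd.pos x inferInstance]

theorem simple_of_square {C : Type u} [Category.{v} C] [Preadditive C] [MonoidalCategory C]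
    [Simple (𝟙_ C)] {x : C} (hx : Nonempty (x ⊗ x ≅ 𝟙_ C)) : Simple x := by
  have := (isInvertibleObj_of_square hx).simple_tensor (Y := 𝟙_ C)
  exact Simple.of_iso (ρ_ x).symm

variable {C : Type u} [Category.{v} C] [Abelian C] [Linear ℂ C] [MonoidalCategory C]
    [MonoidalPreadditive C] [MonoidalLinear ℂ C] [RigidCategory C] [IsFusionCategory C]

/-- The dual of a simple object is simple: taking mates identifies the endomorphisms of an object
with those of its dual. -/
theorem simple_of_exactPairing {X Y : C} [ExactPairing X Y] [Simple X] : Simple Y := by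
  have h0 : 𝟙 Y ≠ 0 := fun h => coevaluation_ne_zero (X := X) (Y := Y) (by
    rw [← Category.comp_id (η_ X Y), ← MonoidalCategory.whiskerLeft_id, h]; simp)
  refine simple_of_forall_smul_id h0 fun g => ?_
  let E₁ := tensorLeftHomEquiv (𝟙_ C) X Y Y
  let E₂ := tensorRightHomEquiv (𝟙_ C) X Y X
  have hρ : (ρ_ Y).hom ≠ 0 := fun h => h0 (by
    rw [← Iso.inv_hom_id (ρ_ Y), h, comp_zero])
  have ha : E₂.symm (E₁ (ρ_ Y).hom) ≠ 0 :=
    tensorRightHomEquiv_symm_ne_zero (tensorLeftHomEquiv_ne_zero hρ)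
  have : Simple (𝟙_ C ⊗ X) := Simple.of_iso (λ_ X)
  obtain ⟨c, hc⟩ := exists_smul_of_simple ha (E₂.symm (E₁ ((ρ_ Y).hom ≫ g)))
  refine ⟨c, ?_⟩
  rw [← tensorRightHomEquiv_symm_smul, ← tensorLeftHomEquiv_smul, E₂.symm.injective.eq_iff,
    E₁.injective.eq_iff] at hc
  rw [← cancel_epi (ρ_ Y).hom, hc, Linear.comp_smul, Category.comp_id]

theorem IsFPDimFunction.lt_of_not_iso {d : C → ℝ} (hd : IsFPDimFunction d) {S X : C} [Simple S]
    {a : S ⟶ X} (ha : a ≠ 0) (h : ¬ Nonempty (S ≅ X)) : d S < d X := by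
  obtain ⟨n, T, ι, π, hT, hιπ, ht, hdX⟩ := exists_simple_resolution X
  obtain ⟨k, hk⟩ : ∃ k, a ≫ π k ≠ 0 := by
    by_contra! hcon
    refine ha ?_
    rw [← Category.comp_id a, ← ht, Preadditive.comp_sum]
    exact Finset.sum_eq_zero fun k _ => by rw [← Category.assoc, hcon, zero_comp]
  have := hT k
  obtain ⟨e⟩ := simple_iso_of_ne_zero hk
  rw [hd.iso _ _ ⟨e⟩, hdX d hd]
  by_cases hall : ∀ l, l = k
  · refine absurd ⟨e ≪≫ ⟨ι k, π k, hιπ k, ?_⟩⟩ h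
    rwa [Finset.sum_eq_single k (fun l _ hl => absurd (hall l) hl) (by simp)] at ht
  · push Not at hall
    obtain ⟨l, hl⟩ := hall
    exact Finset.single_lt_sum hl (Finset.mem_univ k) (Finset.mem_univ l) (hd.pos _ (hT l))
      fun m _ _ => (hd.pos _ (hT m)).le

end Dual

/-! ### The fusion rules of an Ising category -/

/-- Ising fusion rules: the simple objects are `1`, the object `x` of order two and the self-dual
object `s`, with `x ⊗ s ≅ s ≅ s ⊗ x`. The rule `s ⊗ s ≅ 1 ⊕ x` enters through the absence of `s`
from `s ⊗ s`; that `1` and `x` occur in it once each follows by duality. -/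
structure IsingFusion {C : Type u} [Category.{v} C] [Preadditive C] [MonoidalCategory C]
    (x s : C) : Prop where
  simple_unit : Simple (𝟙_ C)
  simple_x : Simple x
  simple_s : Simple s
  x_not_unit : ¬ Nonempty (x ≅ 𝟙_ C)
  s_not_unit : ¬ Nonempty (s ≅ 𝟙_ C)
  s_not_x : ¬ Nonempty (s ≅ x)
  exhaust : ∀ X : C, Simple X → Nonempty (X ≅ 𝟙_ C) ∨ Nonempty (X ≅ x) ∨ Nonempty (X ≅ s)
  pairing : Nonempty (ExactPairing s s)
  x_square : Nonempty (x ⊗ x ≅ 𝟙_ C)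
  s_tensor_x : Nonempty (s ⊗ x ≅ s)
  x_tensor_s : Nonempty (x ⊗ s ≅ s)
  hom_s_square : ∀ a : s ⟶ s ⊗ s, a = 0

section IsingRules

theorem pairwise_not_iso_four {C : Type u} [Category.{v} C] {A B D E : C}
    (hAB : ¬ Nonempty (A ≅ B)) (hAD : ¬ Nonempty (A ≅ D)) (hAE : ¬ Nonempty (A ≅ E))
    (hBD : ¬ Nonempty (B ≅ D)) (hBE : ¬ Nonempty (B ≅ E)) (hDE : ¬ Nonempty (D ≅ E)) :
    ∀ i j : Fin 4, Nonempty (![A, B, D, E] i ≅ ![A, B, D, E] j) → i = j := by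
  have key : ∀ i j : Fin 4, i < j → ¬ Nonempty (![A, B, D, E] i ≅ ![A, B, D, E] j) := by
    intro i j hij
    fin_cases i <;> fin_cases j <;> first | exact absurd hij (by decide) | assumption
  intro i j ⟨e⟩
  rcases lt_trichotomy i j with h | h | h
  · exact absurd ⟨e⟩ (key i j h)
  · exact h
  · exact absurd ⟨e.symm⟩ (key j i h)

theorem pairwise_not_iso_three {C : Type u} [Category.{v} C] {A B D : C}
    (hAB : ¬ Nonempty (A ≅ B)) (hAD : ¬ Nonempty (A ≅ D)) (hBD : ¬ Nonempty (B ≅ D)) :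
    ∀ i j : Fin 3, Nonempty (![A, B, D] i ≅ ![A, B, D] j) → i = j := by
  have key : ∀ i j : Fin 3, i < j → ¬ Nonempty (![A, B, D] i ≅ ![A, B, D] j) := by
    intro i j hij
    fin_cases i <;> fin_cases j <;> first | exact absurd hij (by decide) | assumption
  intro i j ⟨e⟩
  rcases lt_trichotomy i j with h | h | h
  · exact absurd ⟨e⟩ (key i j h)
  · exact h
  · exact absurd ⟨e.symm⟩ (key j i h)

theorem not_iso_symm {C : Type u} [Category.{v} C] {A B : C} (h : ¬ Nonempty (A ≅ B)) :
    ¬ Nonempty (B ≅ A) := fun ⟨e⟩ => h ⟨e.symm⟩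

theorem not_iso_of_isInvertibleObj {C : Type u} [Category.{v} C] [MonoidalCategory C] {A B : C}
    (hA : IsInvertibleObj A) (hB : ¬ IsInvertibleObj B) : ¬ Nonempty (A ≅ B) :=
  fun ⟨e⟩ => hB (hA.of_iso e)

variable {C : Type u} [Category.{v} C] [Abelian C] [Linear ℂ C] [MonoidalCategory C]
    [MonoidalPreadditive C] [MonoidalLinear ℂ C] [RigidCategory C] [BraidedCategory C]
    [IsFusionCategory C]

/-- Unless `s` is invertible, `s ⊗ s*` contains the unit properly. -/
theorem IsFPDimFunction.one_lt_mul_dual {d : C → ℝ} (hd : IsFPDimFunction d) {s t : C}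
    [ExactPairing s t] [Simple s] (hs : ¬ IsInvertibleObj s) : 1 < d s * d t := by
  have : Simple (𝟙_ C) := IsFusionCategory.simple_unit
  rw [← hd.unit, ← hd.tensor]
  refine hd.lt_of_not_iso coevaluation_ne_zero fun ⟨e⟩ => hs ?_
  exact ⟨t, ⟨e.symm⟩, ⟨β_ t s ≪≫ e.symm⟩⟩

theorem not_isInvertibleObj_dual {s t : C} [ExactPairing s t] [Simple s]
    (hs : ¬ IsInvertibleObj s) : ¬ IsInvertibleObj t := by
  intro ht
  have : Simple (𝟙_ C) := IsFusionCategory.simple_unit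
  have := ht.simple_tensor (Y := s)
  have : Simple (s ⊗ t) := Simple.of_iso (β_ s t)
  obtain ⟨e⟩ := simple_iso_of_ne_zero (coevaluation_ne_zero (X := s) (Y := t))
  exact hs ⟨t, ⟨e.symm⟩, ⟨β_ t s ≪≫ e.symm⟩⟩

/-- In an Ising category there is room for only two invertible and one non-invertible simple
objects: the squares of their dimensions are `1`, `1` and `2`. -/
theorem isingFusion (hC : HasFPDim C 4) {x s : C} (hx : Nonempty (x ⊗ x ≅ 𝟙_ C))
    (hx1 : ¬ Nonempty (x ≅ 𝟙_ C)) (hs : Simple s) (hsi : ¬ IsInvertibleObj s) :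
    IsingFusion x s := by
  obtain ⟨d, hd, hsum⟩ := hC
  have h4 : (4 : ℝ) ≠ 0 := by norm_num
  have h1 : Simple (𝟙_ C) := IsFusionCategory.simple_unit
  have hxs : Simple x := simple_of_square hx
  have hdx : d x = 1 := hd.eq_one_of_square hx
  have hxi := isInvertibleObj_of_square hx
  have h1i := isInvertibleObj_unit (C := C)
  have hx1' := not_iso_symm hx1
  -- Two non-isomorphic non-invertible simple objects leave dimension `4 - 1 - 1` for both of them.
  have two : ∀ a b : C, Simple a → Simple b → ¬ IsInvertibleObj a → ¬ IsInvertibleObj b →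
      ¬ Nonempty (a ≅ b) → d a ^ 2 + d b ^ 2 ≤ 2 := by
    intro a b ha hb hai hbi hab
    have := hd.sum_sq_le h4 hsum ![𝟙_ C, x, a, b] (fun i => by fin_cases i <;> assumption)
      (pairwise_not_iso_four hx1' (not_iso_of_isInvertibleObj h1i hai)
        (not_iso_of_isInvertibleObj h1i hbi) (not_iso_of_isInvertibleObj hxi hai)
        (not_iso_of_isInvertibleObj hxi hbi) hab)
    simp [Fin.sum_univ_succ, hd.unit, hdx] at this
    linarith
  have selfdual : ∀ a b : C, ExactPairing a b → Simple a → ¬ IsInvertibleObj a →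
      Nonempty (a ≅ b) := by
    intro a b _ ha hai
    by_contra hab
    have h2 := two a b ha (simple_of_exactPairing (X := a)) hai
      (not_isInvertibleObj_dual (s := a) hai) hab
    nlinarith [hd.one_lt_mul_dual (s := a) (t := b) hai, sq_nonneg (d a - d b)]
  have one_lt : ∀ a : C, Simple a → ¬ IsInvertibleObj a → 1 < d a ^ 2 := by
    intro a ha hai
    have h2 := hd.one_lt_mul_dual (s := a) (t := HasRightDual.rightDual a) hai
    rwa [← hd.iso _ _ (selfdual a (HasRightDual.rightDual a) inferInstance ha hai), ← sq] at h2
  have uniq : ∀ a b : C, Simple a → Simple b → ¬ IsInvertibleObj a → ¬ IsInvertibleObj b →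
      Nonempty (a ≅ b) := by
    intro a b ha hb hai hbi
    by_contra hab
    have := two a b ha hb hai hbi hab
    linarith [one_lt a ha hai, one_lt b hb hbi]
  have absorb : ∀ g : C, IsInvertibleObj g → Nonempty (g ⊗ s ≅ s) := fun g hg =>
    uniq _ _ hg.simple_tensor hs (fun h => hsi h.of_tensor_left) hsi
  have hs1 := not_iso_of_isInvertibleObj h1i hsi
  have hsx := not_iso_of_isInvertibleObj hxi hsi
  have hds := hd.pos s hs
  have hexh : ∀ X : C, Simple X →
      Nonempty (X ≅ 𝟙_ C) ∨ Nonempty (X ≅ x) ∨ Nonempty (X ≅ s) := by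
    intro X hX
    by_cases hXi : IsInvertibleObj X
    · by_contra! hcon
      have hdX : d X = 1 := by
        have := hd.iso _ _ (absorb X hXi)
        rw [hd.tensor] at this
        exact mul_right_cancel₀ hds.ne' (by rw [this, one_mul])
      have := hd.sum_sq_le h4 hsum ![𝟙_ C, x, X, s] (fun i => by fin_cases i <;> assumption)
        (pairwise_not_iso_four hx1' (not_iso_symm (not_nonempty_iff.2 hcon.1)) hs1
          (not_iso_symm (not_nonempty_iff.2 hcon.2.1)) hsx (not_nonempty_iff.2 hcon.2.2))
      simp [Fin.sum_univ_succ, hd.unit, hdx, hdX] at this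
      linarith [one_lt s hs hsi]
    · exact Or.inr (Or.inr (uniq X s hX hs hXi hsi))
  obtain ⟨e⟩ := selfdual s (HasRightDual.rightDual s) inferInstance hs hsi
  have hp : ExactPairing s s := exactPairingCongrRight e
  obtain ⟨exs⟩ := absorb x hxi
  have esx : s ⊗ x ≅ s := β_ _ _ ≪≫ exs
  refine ⟨h1, hxs, hs, hx1, not_iso_symm hs1, not_iso_symm hsx, hexh, ⟨hp⟩, hx, ⟨esx⟩, ⟨exs⟩, ?_⟩
  intro a
  by_contra ha
  have hj : tensorLeftHomEquiv x s s s esx.hom ≠ 0 :=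
    tensorLeftHomEquiv_ne_zero fun h0 => id_nonzero s (by rw [← esx.inv_hom_id, h0, comp_zero])
  have hle := hd.sum_le ![𝟙_ C, x, s] (fun i => by fin_cases i <;> assumption)
    (pairwise_not_iso_three hx1' hs1 hsx) (s ⊗ s)
    (fun i => match i with
      | 0 => η_ s s
      | 1 => tensorLeftHomEquiv x s s s esx.hom
      | 2 => a)
    (fun i => match i with
      | 0 => coevaluation_ne_zero
      | 1 => hj
      | 2 => ha)
  have hsq := hd.sum_sq_le h4 hsum ![𝟙_ C, x, s] (fun i => by fin_cases i <;> assumption)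
    (pairwise_not_iso_three hx1' hs1 hsx)
  simp [Fin.sum_univ_succ, hd.unit, hdx, hd.tensor] at hle hsq
  nlinarith

end IsingRules

/-! ### Morphisms intertwining structure maps `X ⟶ F X` -/

section Intertwines

open Functor.LaxMonoidal

variable {C : Type u} [Category.{v} C]

/-- The structure map `X ⊗ Y ⟶ F (X ⊗ Y)` induced by structure maps on `X` and `Y`. -/
def tensorStr [MonoidalCategory C] (F : C ⥤ C) [F.Monoidal] {X Y : C}
    (a : X ⟶ F.obj X) (b : Y ⟶ F.obj Y) :
    X ⊗ Y ⟶ F.obj (X ⊗ Y) := (a ⊗ₘ b) ≫ μ F X Y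

instance [MonoidalCategory C] (F : C ⥤ C) [F.Monoidal] {X Y : C}
    (a : X ⟶ F.obj X) (b : Y ⟶ F.obj Y) [IsIso a]
    [IsIso b] : IsIso (tensorStr F a b) := by unfold tensorStr; infer_instance

variable [Preadditive C] [Linear ℂ C]

/-- The morphism `g` is compatible with the structure maps `a` on `X` and `b` on `Y` up to the
scalar `c`. -/
def Intertwines (F : C ⥤ C) {X Y : C} (a : X ⟶ F.obj X) (b : Y ⟶ F.obj Y) (g : X ⟶ Y) (c : ℂ) :
    Prop := a ≫ F.map g = c • (g ≫ b)

namespace Intertwines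

variable {F : C ⥤ C} {X Y Z : C} {a : X ⟶ F.obj X} {b : Y ⟶ F.obj Y} {d : Z ⟶ F.obj Z}

theorem comp {g : X ⟶ Y} {k : Y ⟶ Z} {c e : ℂ} (h₁ : Intertwines F a b g c)
    (h₂ : Intertwines F b d k e) : Intertwines F a d (g ≫ k) (c * e) := by
  unfold Intertwines at *
  rw [F.map_comp, ← Category.assoc, h₁, Linear.smul_comp, Category.assoc, h₂, Linear.comp_smul,
    smul_smul, Category.assoc]

theorem inv {g : X ≅ Y} (h : Intertwines F a b g.hom 1) : Intertwines F b a g.inv 1 := by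
  unfold Intertwines at *
  rw [one_smul] at *
  rw [← cancel_epi g.hom, ← cancel_mono (F.map g.hom)]
  simp only [Category.assoc, ← F.map_comp, Iso.inv_hom_id, F.map_id, Category.comp_id,
    Iso.hom_inv_id_assoc]
  exact h.symm

/-- The scalar is determined by a morphism which does not become zero. -/
theorem scalar_eq {g : X ⟶ Y} {c e : ℂ} [IsIso b] (hg : g ≠ 0) (h₁ : Intertwines F a b g c)
    (h₂ : Intertwines F a b g e) : c = e := by
  unfold Intertwines at *
  rw [h₁] at h₂
  have h0 : g ≫ b ≠ 0 := fun h0 => hg (by rw [← cancel_mono b, h0, zero_comp])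
  exact smul_left_injective ℂ h0 h₂

theorem of_naturality {η : 𝟭 C ⟶ F} {X Y : C} (g : X ⟶ Y) :
    Intertwines F (η.app X) (η.app Y) g 1 := by
  rw [Intertwines, one_smul]
  exact (η.naturality g).symm

variable [MonoidalCategory C] [F.Monoidal]

theorem associator : Intertwines F (tensorStr F (tensorStr F a b) d)
    (tensorStr F a (tensorStr F b d)) (α_ X Y Z).hom 1 := by
  rw [Intertwines, one_smul]
  simp only [tensorStr, Category.assoc]
  calc ((a ⊗ₘ b) ≫ μ F X Y ⊗ₘ d) ≫ μ F (X ⊗ Y) Z ≫ F.map (α_ X Y Z).hom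
      = ((a ⊗ₘ b) ⊗ₘ d) ≫ (μ F X Y ▷ F.obj Z ≫ μ F (X ⊗ Y) Z ≫ F.map (α_ X Y Z).hom) := by
        rw [← Category.comp_id d, ← MonoidalCategory.tensorHom_comp_tensorHom,
          MonoidalCategory.tensorHom_id]
        simp
    _ = _ := by
        rw [Functor.LaxMonoidal.associativity, MonoidalCategory.associator_naturality_assoc]
        nth_rewrite 2 [← Category.comp_id a]
        rw [← MonoidalCategory.tensorHom_comp_tensorHom, MonoidalCategory.id_tensorHom,
          Category.assoc]

theorem associator_inv : Intertwines F (tensorStr F a (tensorStr F b d))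
    (tensorStr F (tensorStr F a b) d) (α_ X Y Z).inv 1 := associator.inv

theorem leftUnitor : Intertwines F (tensorStr F (ε F) a) a (λ_ X).hom 1 := by
  rw [Intertwines, one_smul, tensorStr, ← leftUnitor_naturality, Functor.LaxMonoidal.left_unitality,
    MonoidalCategory.tensorHom_def']
  simp

theorem rightUnitor : Intertwines F (tensorStr F a (ε F)) a (ρ_ X).hom 1 := by
  rw [Intertwines, one_smul, tensorStr, ← rightUnitor_naturality,
    Functor.LaxMonoidal.right_unitality, MonoidalCategory.tensorHom_def]
  simp

variable [MonoidalPreadditive C] [MonoidalLinear ℂ C]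

theorem whiskerLeft (d : Z ⟶ F.obj Z) {g : X ⟶ Y} {c : ℂ} (h : Intertwines F a b g c) :
    Intertwines F (tensorStr F d a) (tensorStr F d b) (Z ◁ g) c := by
  unfold Intertwines tensorStr at *
  calc ((d ⊗ₘ a) ≫ μ F Z X) ≫ F.map (Z ◁ g) = (d ⊗ₘ (a ≫ F.map g)) ≫ μ F Z Y := by
        rw [Category.assoc, ← Functor.LaxMonoidal.μ_natural_right, ← MonoidalCategory.id_tensorHom,
          MonoidalCategory.tensorHom_comp_tensorHom_assoc, Category.comp_id]
    _ = _ := by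
        rw [h, MonoidalCategory.tensorHom_def, MonoidalLinear.whiskerLeft_smul,
          MonoidalCategory.tensorHom_def']
        simp [whisker_exchange_assoc]

theorem whiskerRight (d : Z ⟶ F.obj Z) {g : X ⟶ Y} {c : ℂ} (h : Intertwines F a b g c) :
    Intertwines F (tensorStr F a d) (tensorStr F b d) (g ▷ Z) c := by
  unfold Intertwines tensorStr at *
  calc ((a ⊗ₘ d) ≫ μ F X Z) ≫ F.map (g ▷ Z) = ((a ≫ F.map g) ⊗ₘ d) ≫ μ F Y Z := by
        rw [Category.assoc, ← Functor.LaxMonoidal.μ_natural_left, ← MonoidalCategory.tensorHom_id,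
          MonoidalCategory.tensorHom_comp_tensorHom_assoc, Category.comp_id]
    _ = _ := by
        rw [h, MonoidalCategory.tensorHom_def', MonoidalLinear.smul_whiskerRight,
          MonoidalCategory.tensorHom_def]
        simp [whisker_exchange_assoc]

end Intertwines

end Intertwines

/-! ### Extending isomorphisms from simple objects -/

section Extension

open Functor.LaxMonoidal

variable {C : Type u} [Category.{v} C] [Abelian C] [Linear ℂ C] [MonoidalCategory C]
    [MonoidalPreadditive C] [MonoidalLinear ℂ C] [RigidCategory C] [IsFusionCategory C]

/-- The inclusions in a decomposition of `A` are jointly epimorphic. -/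
theorem eq_of_sum_comp_eq_id {C : Type u} [Category.{v} C] [Preadditive C] {A B : C} {n : ℕ}
    {T : Fin n → C} {p : ∀ i, A ⟶ T i}
    {q : ∀ i, T i ⟶ A} (h : ∑ i, p i ≫ q i = 𝟙 A) {g g' : A ⟶ B} (hg : ∀ i, q i ≫ g = q i ≫ g') :
    g = g' := by
  rw [← Category.id_comp g, ← Category.id_comp g', ← h, Preadditive.sum_comp,
    Preadditive.sum_comp]
  exact Finset.sum_congr rfl fun i _ => by rw [Category.assoc, Category.assoc, hg]

/-- Every object is resolved by the objects of a family meeting all isomorphism classes of simple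
objects. -/
theorem exists_resolution_of_exhaust {I : Type} (S : I → C)
    (hex : ∀ X : C, Simple X → ∃ i, Nonempty (X ≅ S i)) (X : C) :
    ∃ (n : ℕ) (k : Fin n → I) (ι : ∀ i, S (k i) ⟶ X) (π : ∀ i, X ⟶ S (k i)),
      ∑ i, π i ≫ ι i = 𝟙 X := by
  obtain ⟨n, T, ι, π, hT, -, ht, -⟩ := exists_simple_resolution X
  choose k hk using fun i => hex (T i) (hT i)
  let e : ∀ i, T i ≅ S (k i) := fun i => (hk i).some
  exact ⟨n, k, fun i => (e i).inv ≫ ι i, fun i => π i ≫ (e i).hom, by simpa using ht⟩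

/-- Isomorphisms `S i ≅ F (S i)` for representatives `S i` of the simple objects extend to a
natural isomorphism. -/
theorem exists_natIso_of_simples {I : Type} (S : I → C) (hS : ∀ i, Simple (S i))
    (hne : ∀ i j, Nonempty (S i ≅ S j) → i = j)
    (hex : ∀ X : C, Simple X → ∃ i, Nonempty (X ≅ S i))
    (F : C ⥤ C) [F.Additive] [F.Linear ℂ] (a : ∀ i, S i ≅ F.obj (S i)) :
    ∃ η : 𝟭 C ≅ F, ∀ i, η.hom.app (S i) = (a i).hom := by
  choose n k ι π ht using exists_resolution_of_exhaust S hex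
  have hnat : ∀ (i j : I) (g : S i ⟶ S j), g ≫ (a j).hom = (a i).hom ≫ F.map g := by
    intro i j g
    have := hS i
    have := hS j
    by_cases hij : i = j
    · subst hij
      obtain ⟨c, rfl⟩ := exists_smul_id g
      simp [F.map_smul]
    · rw [eq_zero_of_isEmpty_iso (fun h => hij (hne i j h)) g]
      simp
  let app : ∀ X : C, X ⟶ F.obj X := fun X => ∑ i, π X i ≫ (a (k X i)).hom ≫ F.map (ι X i)
  have happ : ∀ (i : I) (X : C) (g : S i ⟶ X), g ≫ app X = (a i).hom ≫ F.map g := by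
    intro i X g
    calc g ≫ app X = ∑ l, (g ≫ π X l) ≫ (a (k X l)).hom ≫ F.map (ι X l) := by
          simp only [app, Preadditive.comp_sum, Category.assoc]
      _ = ∑ l, (a i).hom ≫ F.map (g ≫ π X l ≫ ι X l) := by
          refine Finset.sum_congr rfl fun l _ => ?_
          rw [← Category.assoc, hnat]
          simp
      _ = (a i).hom ≫ F.map (g ≫ 𝟙 X) := by
          rw [← ht X, Preadditive.comp_sum, F.map_sum, Preadditive.comp_sum]
      _ = _ := by simp
  have hnat' : ∀ {X Y : C} (g : X ⟶ Y), g ≫ app Y = app X ≫ F.map g := by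
    intro X Y g
    calc g ≫ app Y = (∑ i, π X i ≫ ι X i) ≫ g ≫ app Y := by rw [ht, Category.id_comp]
      _ = ∑ i, π X i ≫ (ι X i ≫ g) ≫ app Y := by
          rw [Preadditive.sum_comp]; simp only [Category.assoc]
      _ = app X ≫ F.map g := by
          simp only [happ, app, Preadditive.sum_comp, F.map_comp, Category.assoc]
  let inv : ∀ X : C, F.obj X ⟶ X := fun X => ∑ i, F.map (π X i) ≫ (a (k X i)).inv ≫ ι X i
  refine ⟨NatIso.ofComponents (fun X => ⟨app X, inv X, ?_, ?_⟩) (fun g => hnat' g), fun i => ?_⟩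
  · calc app X ≫ inv X = ∑ i, (app X ≫ F.map (π X i)) ≫ (a (k X i)).inv ≫ ι X i := by
          simp only [inv, Preadditive.comp_sum, Category.assoc]
      _ = ∑ i, π X i ≫ ι X i := by
          refine Finset.sum_congr rfl fun i _ => ?_
          rw [← hnat', Category.assoc]
          have h := happ (k X i) _ (𝟙 (S (k X i)))
          rw [Category.id_comp, F.map_id, Category.comp_id] at h
          rw [h]
          simp
      _ = 𝟙 X := ht X
  · calc inv X ≫ app X = ∑ i, F.map (π X i) ≫ (a (k X i)).inv ≫ ι X i ≫ app X := by
          simp only [inv, Preadditive.sum_comp, Category.assoc]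
      _ = ∑ i, F.map (π X i ≫ ι X i) := by simp [happ]
      _ = 𝟙 _ := by rw [← F.map_sum, ht, F.map_id]
  · have h := happ i _ (𝟙 (S i))
    rw [Category.id_comp, F.map_id, Category.comp_id] at h
    exact h

/-- A natural transformation `id ⟶ F` is compatible with tensor products as soon as it is so for
pairs of simple objects. -/
theorem tensor_of_simples {I : Type} (S : I → C)
    (hex : ∀ X : C, Simple X → ∃ i, Nonempty (X ≅ S i))
    (F : C ⥤ C) [F.Monoidal] (η : 𝟭 C ⟶ F)
    (h : ∀ i j, η.app (S i ⊗ S j) = tensorStr F (η.app (S i)) (η.app (S j))) (X Y : C) :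
    η.app (X ⊗ Y) = tensorStr F (η.app X) (η.app Y) := by
  have nat : ∀ {A B : C} (g : A ⟶ B), η.app A ≫ F.map g = g ≫ η.app B :=
    fun g => (η.naturality g).symm
  have wr : ∀ {A B : C} (g : A ⟶ B) (D : C), g ▷ D ≫ tensorStr F (η.app B) (η.app D) =
      tensorStr F (η.app A) (η.app D) ≫ F.map (g ▷ D) := fun {A B} g D => by
    have := (Intertwines.of_naturality (η := η) g).whiskerRight (η.app D)
    rw [Intertwines, one_smul] at this
    exact this.symm
  have wl : ∀ {A B : C} (g : A ⟶ B) (D : C), D ◁ g ≫ tensorStr F (η.app D) (η.app B) =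
      tensorStr F (η.app D) (η.app A) ≫ F.map (D ◁ g) := fun {A B} g D => by
    have := (Intertwines.of_naturality (η := η) g).whiskerLeft (η.app D)
    rw [Intertwines, one_smul] at this
    exact this.symm
  have step : ∀ (j : I) (X : C), η.app (X ⊗ S j) = tensorStr F (η.app X) (η.app (S j)) := by
    intro j X
    obtain ⟨n, k, ι, π, ht⟩ := exists_resolution_of_exhaust S hex X
    have hid : ∑ i, π i ▷ S j ≫ ι i ▷ S j = 𝟙 (X ⊗ S j) := by
      simp only [← comp_whiskerRight, ← sum_whiskerRight, ht, MonoidalCategory.id_whiskerRight]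
    refine eq_of_sum_comp_eq_id hid fun i => ?_
    rw [wr, ← nat, h]
  obtain ⟨n, k, ι, π, ht⟩ := exists_resolution_of_exhaust S hex Y
  have hid : ∑ i, X ◁ π i ≫ X ◁ ι i = 𝟙 (X ⊗ Y) := by
    simp only [← MonoidalCategory.whiskerLeft_comp, ← whiskerLeft_sum, ht,
      MonoidalCategory.whiskerLeft_id]
  refine eq_of_sum_comp_eq_id hid fun i => ?_
  rw [wl, ← nat, step]

end Extension

/-! ### Tensor autoequivalences of an Ising category -/

section Rigidity

open Functor.LaxMonoidal

namespace IsingFusion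

section

variable {C : Type u} [Category.{v} C] [Abelian C] [MonoidalCategory C]
    {x s : C} (h : IsingFusion x s)

include h

theorem simples (i : Fin 3) : Simple (![𝟙_ C, x, s] i) := by
  have := h.simple_unit
  have := h.simple_x
  have := h.simple_s
  fin_cases i <;> assumption

theorem simples_not_iso : ∀ i j : Fin 3,
    Nonempty (![𝟙_ C, x, s] i ≅ ![𝟙_ C, x, s] j) → i = j :=
  pairwise_not_iso_three (not_iso_symm h.x_not_unit) (not_iso_symm h.s_not_unit)
    (not_iso_symm h.s_not_x)

theorem simples_exhaust (X : C) (hX : Simple X) : ∃ i : Fin 3, Nonempty (X ≅ ![𝟙_ C, x, s] i) := by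
  rcases h.exhaust X hX with hX | hX | hX
  exacts [⟨0, hX⟩, ⟨1, hX⟩, ⟨2, hX⟩]

theorem simple_s_tensor_x : Simple (s ⊗ x) :=
  have := h.simple_s
  Simple.of_iso h.s_tensor_x.some

theorem simple_x_tensor_s : Simple (x ⊗ s) :=
  have := h.simple_s
  Simple.of_iso h.x_tensor_s.some

variable [MonoidalPreadditive C]

theorem evaluation_ne_zero [ExactPairing s s] : ε_ s s ≠ 0 := by
  intro h0
  have := h.simple_s
  have hz := ExactPairing.evaluation_coevaluation s s
  rw [h0] at hz
  have h1 : (λ_ s).hom ≫ (ρ_ s).inv = 0 := by rw [← hz]; simp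
  refine id_nonzero s ?_
  calc 𝟙 s = (λ_ s).inv ≫ ((λ_ s).hom ≫ (ρ_ s).inv) ≫ (ρ_ s).hom := by simp
    _ = 0 := by rw [h1]; simp

variable [Linear ℂ C] [MonoidalLinear ℂ C]

theorem exists_ne_zero_hom_x [ExactPairing s s] : ∃ j : x ⟶ s ⊗ s, j ≠ 0 := by
  obtain ⟨e⟩ := h.s_tensor_x
  have := h.simple_s
  exact ⟨tensorLeftHomEquiv x s s s e.hom, tensorLeftHomEquiv_ne_zero fun h0 =>
    id_nonzero s (by rw [← e.inv_hom_id, h0, comp_zero])⟩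

end

variable {C : Type u} [Category.{v} C] [Abelian C] [Linear ℂ C] [MonoidalCategory C]
    [MonoidalPreadditive C] [MonoidalLinear ℂ C] [RigidCategory C] [IsFusionCategory C]
    {x s : C} (h : IsingFusion x s)

include h

theorem exists_smul_of_simple_tensor [ExactPairing s s] {X : C} [Simple (s ⊗ X)] {a : X ⟶ s ⊗ s}
    (ha : a ≠ 0) (g : X ⟶ s ⊗ s) : ∃ c : ℂ, g = c • a := by
  have := h.simple_s
  obtain ⟨c, hc⟩ := exists_smul_of_simple (tensorLeftHomEquiv_symm_ne_zero (Y' := s) ha)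
    ((tensorLeftHomEquiv X s s s).symm g)
  refine ⟨c, ?_⟩
  rwa [← tensorLeftHomEquiv_symm_smul, Equiv.apply_eq_iff_eq] at hc

theorem exists_smul_coevaluation [ExactPairing s s] (g : 𝟙_ C ⟶ s ⊗ s) :
    ∃ c : ℂ, g = c • η_ s s := by
  have := h.simple_s
  have : Simple (s ⊗ 𝟙_ C) := Simple.of_iso (ρ_ s)
  exact h.exists_smul_of_simple_tensor coevaluation_ne_zero g

theorem exists_smul_evaluation [ExactPairing s s] (g : s ⊗ s ⟶ 𝟙_ C) :
    ∃ c : ℂ, g = c • ε_ s s := by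
  have := h.simple_s
  have : Simple (s ⊗ 𝟙_ C) := Simple.of_iso (ρ_ s)
  let E := tensorLeftHomEquiv s s s (𝟙_ C)
  have h0 : E (ε_ s s) ≠ 0 := tensorLeftHomEquiv_ne_zero h.evaluation_ne_zero
  obtain ⟨c, hc⟩ := exists_smul_of_simple h0 (E g)
  refine ⟨c, ?_⟩
  rwa [← tensorLeftHomEquiv_smul, E.apply_eq_iff_eq] at hc

/-- The embeddings of `1` and `x` in `s ⊗ s` are jointly epimorphic: there is no further
constituent. -/
theorem tensor_ext [ExactPairing s s] {j : x ⟶ s ⊗ s} (hj : j ≠ 0) {B : C} {g g' : s ⊗ s ⟶ B}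
    (h₁ : η_ s s ≫ g = η_ s s ≫ g') (h₂ : j ≫ g = j ≫ g') : g = g' := by
  have := h.simple_s_tensor_x
  obtain ⟨n, k, ι, π, ht⟩ := exists_resolution_of_exhaust _ h.simples_exhaust (s ⊗ s)
  have key : ∀ (i : Fin 3) (q : ![𝟙_ C, x, s] i ⟶ s ⊗ s), q ≫ g = q ≫ g' := fun i => match i with
    | 0 => fun (q : 𝟙_ C ⟶ s ⊗ s) => by
      change q ≫ g = q ≫ g'
      obtain ⟨c, rfl⟩ := h.exists_smul_coevaluation q
      rw [Linear.smul_comp, Linear.smul_comp, h₁]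
    | 1 => fun (q : x ⟶ s ⊗ s) => by
      change q ≫ g = q ≫ g'
      obtain ⟨c, rfl⟩ := h.exists_smul_of_simple_tensor hj q
      rw [Linear.smul_comp, Linear.smul_comp, h₂]
    | 2 => fun (q : s ⟶ s ⊗ s) => by
      change q ≫ g = q ≫ g'
      rw [h.hom_s_square q, zero_comp, zero_comp]
  exact eq_of_sum_comp_eq_id ht fun i => key _ _

variable (F : C ⥤ C) [F.Monoidal]

/-- Any isomorphism `s ≅ F s` can be rescaled so as to respect the pairing of `s` with itself. -/
theorem exists_intertwines_coevaluation [F.Additive] [F.IsEquivalence] [ExactPairing s s]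
    (hs : Nonempty (s ≅ F.obj s)) :
    ∃ w : s ≅ F.obj s, Intertwines F (ε F) (tensorStr F w.hom w.hom) (η_ s s) 1 := by
  obtain ⟨w₀⟩ := hs
  have := h.simple_s
  obtain ⟨c, hc⟩ := h.exists_smul_coevaluation
    (ε F ≫ F.map (η_ s s) ≫ inv (tensorStr F w₀.hom w₀.hom))
  have hc' : ε F ≫ F.map (η_ s s) = c • (η_ s s ≫ tensorStr F w₀.hom w₀.hom) := by
    rw [← Linear.smul_comp, ← hc]; simp
  have hc0 : c ≠ 0 := by
    rintro rfl
    rw [zero_smul] at hc'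
    have h1 : F.map (η_ s s) = F.map 0 := by
      rw [F.map_zero, ← cancel_epi (ε F), hc', comp_zero]
    exact coevaluation_ne_zero (F.map_injective h1)
  obtain ⟨r, hr⟩ := IsAlgClosed.exists_eq_mul_self c
  have hr0 : r ≠ 0 := by rintro rfl; simp at hr; exact hc0 hr
  refine ⟨⟨r • w₀.hom, r⁻¹ • w₀.inv, by simp [smul_smul, hr0], by simp [smul_smul, hr0]⟩, ?_⟩
  rw [Intertwines, hc', one_smul, ← Linear.comp_smul]
  congr 1
  simp [tensorStr, MonoidalCategory.tensorHom_def, smul_smul, hr]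

/-- The embedding `j` of `x` in `s ⊗ s` pins down the structure map on `x`. -/
theorem exists_intertwines_x [F.Additive] [F.IsEquivalence] [ExactPairing s s]
    (hx : Nonempty (x ≅ F.obj x)) {j : x ⟶ s ⊗ s}
    (hj : j ≠ 0) (w : s ≅ F.obj s) :
    ∃ a : x ≅ F.obj x, Intertwines F a.hom (tensorStr F w.hom w.hom) j 1 := by
  obtain ⟨a₀⟩ := hx
  have := h.simple_s_tensor_x
  obtain ⟨c, hc⟩ := h.exists_smul_of_simple_tensor hj
    (a₀.hom ≫ F.map j ≫ inv (tensorStr F w.hom w.hom))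
  have hc' : a₀.hom ≫ F.map j = c • (j ≫ tensorStr F w.hom w.hom) := by
    rw [← Linear.smul_comp, ← hc]; simp
  have hc0 : c ≠ 0 := by
    rintro rfl
    rw [zero_smul] at hc'
    have h1 : F.map j = F.map 0 := by
      rw [F.map_zero, ← cancel_epi a₀.hom, hc', comp_zero]
    exact hj (F.map_injective h1)
  refine ⟨⟨c⁻¹ • a₀.hom, c • a₀.inv, by simp [smul_smul, hc0], by simp [smul_smul, hc0]⟩, ?_⟩
  change (c⁻¹ • a₀.hom) ≫ F.map j = (1 : ℂ) • (j ≫ tensorStr F w.hom w.hom)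
  rw [one_smul, Linear.smul_comp, hc', smul_smul, inv_mul_cancel₀ hc0, one_smul]

/-- A structure map on `s` respecting the coevaluation respects the evaluation, because of the
zigzag identity. -/
theorem intertwines_evaluation [ExactPairing s s] (w : s ≅ F.obj s)
    (hw : Intertwines F (ε F) (tensorStr F w.hom w.hom) (η_ s s) 1) :
    Intertwines F (tensorStr F w.hom w.hom) (ε F) (ε_ s s) 1 := by
  have := h.simple_s
  obtain ⟨c, hc⟩ := h.exists_smul_evaluation
    (tensorStr F w.hom w.hom ≫ F.map (ε_ s s) ≫ inv (ε F))
  have hev : Intertwines F (tensorStr F w.hom w.hom) (ε F) (ε_ s s) c := by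
    rw [Intertwines, ← Linear.smul_comp, ← hc]; simp
  have hz := ((hw.whiskerRight w.hom).comp Intertwines.associator).comp (hev.whiskerLeft w.hom)
  have hu := (Intertwines.leftUnitor (F := F) (a := w.hom)).comp
    (Intertwines.rightUnitor (F := F) (a := w.hom) (X := s)).inv
  rw [Category.assoc, ExactPairing.evaluation_coevaluation] at hz
  have hne : (λ_ s).hom ≫ (ρ_ s).inv ≠ 0 := fun h0 => id_nonzero s (by
    calc 𝟙 s = (λ_ s).inv ≫ ((λ_ s).hom ≫ (ρ_ s).inv) ≫ (ρ_ s).hom := by simp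
      _ = 0 := by rw [h0]; simp)
  have := Intertwines.scalar_eq hne hz hu
  simp only [one_mul] at this
  rwa [this] at hev

end IsingFusion

end Rigidity

section TensorIso

open Functor.LaxMonoidal

section

variable {C : Type u} [Category.{v} C] [Preadditive C] [Linear ℂ C] [MonoidalCategory C]
    {F : C ⥤ C} [F.Monoidal]

theorem app_tensor_eq_of_isIso {η : 𝟭 C ⟶ F} {X Y Z : C} (g : X ⊗ Y ⟶ Z) [IsIso g]
    (hg : Intertwines F (tensorStr F (η.app X) (η.app Y)) (η.app Z) g 1) :
    η.app (X ⊗ Y) = tensorStr F (η.app X) (η.app Y) := by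
  rw [Intertwines, one_smul] at hg
  rw [← cancel_mono (F.map g), hg]
  exact (η.naturality g).symm

theorem tensorStr_smul_smul [MonoidalPreadditive C] [MonoidalLinear ℂ C] {X Y : C}
    (a : X ⟶ F.obj X) (b : Y ⟶ F.obj Y) (r : ℂ) :
    tensorStr F (r • a) (r • b) = (r * r) • tensorStr F a b := by
  simp [tensorStr, MonoidalCategory.tensorHom_def, smul_smul]

end

section

variable {C : Type u} [Category.{v} C] [MonoidalCategory C] {F : C ⥤ C} [F.Monoidal]

theorem app_unit_of_isMonoidal (η : 𝟭 C ⟶ F) [NatTrans.IsMonoidal η] :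
    η.app (𝟙_ C) = ε F := by
  have := NatTrans.IsMonoidal.unit (τ := η)
  rwa [Functor.LaxMonoidal.id_ε, Category.id_comp] at this

theorem app_tensor_of_isMonoidal (η : 𝟭 C ⟶ F) [NatTrans.IsMonoidal η] (X Y : C) :
    η.app (X ⊗ Y) = tensorStr F (η.app X) (η.app Y) := by
  have := NatTrans.IsMonoidal.tensor (τ := η) X Y
  rwa [Functor.LaxMonoidal.id_μ, Category.id_comp] at this

end

namespace IsingFusion

theorem iso_obj_s {C : Type u} [Category.{v} C] [Preadditive C] [MonoidalCategory C]
    [BraidedCategory C] {x s : C} (h : IsingFusion x s) (F : C ⥤ C) [F.Monoidal] [F.IsEquivalence]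
    (hs : ¬ IsInvertibleObj s) : Nonempty (s ≅ F.obj s) := by
  have := h.simple_unit
  have := h.simple_s
  have := h.simple_x
  have hFs : Simple (F.obj s) := simple_obj F s
  have hFi : ¬ IsInvertibleObj (F.obj s) := by
    rintro ⟨Y, ⟨p⟩, -⟩
    have e : s ⊗ F.objPreimage Y ≅ 𝟙_ C := F.preimageIso
      ((Functor.Monoidal.μIso F _ _).symm ≪≫ whiskerLeftIso _ (F.objObjPreimageIso Y) ≪≫ p ≪≫
        Functor.Monoidal.εIso F)
    exact hs ⟨_, ⟨e⟩, ⟨β_ _ _ ≪≫ e⟩⟩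
  rcases h.exhaust _ hFs with e | e | ⟨⟨e⟩⟩
  · exact absurd (isInvertibleObj_unit.of_iso e.some.symm) hFi
  · exact absurd ((isInvertibleObj_of_square h.x_square).of_iso e.some.symm) hFi
  · exact ⟨e.symm⟩

section

variable {C : Type u} [Category.{v} C] [Abelian C] [Linear ℂ C] [MonoidalCategory C]
    [MonoidalPreadditive C] [MonoidalLinear ℂ C] {x s : C} (h : IsingFusion x s)

include h

theorem isIso_tensorRightHomEquiv_symm [ExactPairing s s] {j : x ⟶ s ⊗ s} (hj : j ≠ 0) :
    IsIso ((tensorRightHomEquiv x s s s).symm j) :=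
  have := h.simple_x_tensor_s
  have := h.simple_s
  isIso_of_hom_simple (tensorRightHomEquiv_symm_ne_zero hj)

theorem isIso_tensorLeftHomEquiv_symm [ExactPairing s s] {j : x ⟶ s ⊗ s} (hj : j ≠ 0) :
    IsIso ((tensorLeftHomEquiv x s s s).symm j) :=
  have := h.simple_s_tensor_x
  have := h.simple_s
  isIso_of_hom_simple (tensorLeftHomEquiv_symm_ne_zero hj)

end

variable {C : Type u} [Category.{v} C] [Abelian C] [Linear ℂ C] [MonoidalCategory C]
    [MonoidalPreadditive C] [MonoidalLinear ℂ C] [RigidCategory C] [IsFusionCategory C]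
    {x s : C} (h : IsingFusion x s)

include h

variable {F : C ⥤ C} [F.Monoidal]

/-- The action `x ⊗ s ⟶ s`, being the mate of `j`, is built from morphisms which are respected. -/
theorem intertwines_left_action [ExactPairing s s] {w : s ≅ F.obj s}
    (hw : Intertwines F (ε F) (tensorStr F w.hom w.hom) (η_ s s) 1) {j : x ⟶ s ⊗ s}
    {a : x ⟶ F.obj x} (ha : Intertwines F a (tensorStr F w.hom w.hom) j 1) :
    Intertwines F (tensorStr F a w.hom) w.hom ((tensorRightHomEquiv x s s s).symm j) 1 := by
  have := ((ha.whiskerRight w.hom).comp Intertwines.associator).comp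
    (((h.intertwines_evaluation F w hw).whiskerLeft w.hom).comp Intertwines.rightUnitor)
  simpa [tensorRightHomEquiv] using this

theorem intertwines_right_action [ExactPairing s s] {w : s ≅ F.obj s}
    (hw : Intertwines F (ε F) (tensorStr F w.hom w.hom) (η_ s s) 1) {j : x ⟶ s ⊗ s}
    {a : x ⟶ F.obj x} (ha : Intertwines F a (tensorStr F w.hom w.hom) j 1) :
    Intertwines F (tensorStr F w.hom a) w.hom ((tensorLeftHomEquiv x s s s).symm j) 1 := by
  have := ((ha.whiskerLeft w.hom).comp Intertwines.associator_inv).comp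
    (((h.intertwines_evaluation F w hw).whiskerRight w.hom).comp Intertwines.leftUnitor)
  simpa [tensorLeftHomEquiv] using this

/-- The isomorphism `x ⊗ x ≅ 1` is respected exactly, and not merely up to a scalar, because `x` acts
on `s`. -/
theorem intertwines_square [F.Additive] [F.Linear ℂ] [ExactPairing s s] {w : s ≅ F.obj s}
    (hw : Intertwines F (ε F) (tensorStr F w.hom w.hom) (η_ s s) 1) {j : x ⟶ s ⊗ s} (hj : j ≠ 0)
    {a : x ≅ F.obj x} (ha : Intertwines F a.hom (tensorStr F w.hom w.hom) j 1)
    (m : x ⊗ x ≅ 𝟙_ C) : Intertwines F (tensorStr F a.hom a.hom) (ε F) m.hom 1 := by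
  have := h.simple_unit
  have := h.simple_s
  obtain ⟨c, hc⟩ := exists_smul_id
    (m.inv ≫ tensorStr F a.hom a.hom ≫ F.map m.hom ≫ inv (ε F))
  have hm : Intertwines F (tensorStr F a.hom a.hom) (ε F) m.hom c := by
    rw [Intertwines, ← cancel_mono (inv (ε F)), ← cancel_epi m.inv, Category.assoc, hc]
    simp
  have hl := h.intertwines_left_action hw ha
  set l := (tensorRightHomEquiv x s s s).symm j
  have : IsIso l := h.isIso_tensorRightHomEquiv_symm hj
  have h1 := (hm.whiskerRight w.hom).comp Intertwines.leftUnitor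
  have h2 := Intertwines.associator.comp ((hl.whiskerLeft a.hom).comp hl)
  have : Simple ((x ⊗ x) ⊗ s) := Simple.of_iso (whiskerRightIso m s ≪≫ λ_ s)
  have hne : ∀ g : (x ⊗ x) ⊗ s ⟶ s, IsIso g → g ≠ 0 := fun g _ => (isIso_iff_nonzero g).1 ‹_›
  obtain ⟨r, hr⟩ := exists_smul_of_simple
    (hne (m.hom ▷ s ≫ (λ_ s).hom) inferInstance)
    ((α_ x x s).hom ≫ x ◁ l ≫ l)
  have h3 : Intertwines F (tensorStr F (tensorStr F a.hom a.hom) w.hom) w.hom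
      ((α_ x x s).hom ≫ x ◁ l ≫ l) (c * 1) := by
    rw [hr]
    unfold Intertwines at h1 ⊢
    rw [F.map_smul, Linear.comp_smul, h1, Linear.smul_comp, smul_comm]
  have := Intertwines.scalar_eq (hne _ inferInstance) h3 h2
  simp only [mul_one] at this
  rwa [this] at hm

/-- Two tensor isomorphisms agree up to sign at `s`. -/
theorem exists_app_s_eq_smul [ExactPairing s s] (η η' : 𝟭 C ≅ F) [NatTrans.IsMonoidal η.hom]
    [NatTrans.IsMonoidal η'.hom] : ∃ r : ℂ, r * r = 1 ∧ η'.hom.app s = r • η.hom.app s := by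
  have := h.simple_s
  obtain ⟨c, hc⟩ := exists_smul_id (S := s) ((η'.app s).hom ≫ (η.app s).inv)
  have hc' : η'.hom.app s = c • η.hom.app s := by
    have := congrArg (fun t : s ⟶ s => t ≫ (η.app s).hom) hc
    simpa using this
  refine ⟨c, ?_, hc'⟩
  have h1 := Intertwines.of_naturality (η := η.hom) (η_ s s)
  have h2 := Intertwines.of_naturality (η := η'.hom) (η_ s s)
  rw [app_unit_of_isMonoidal, app_tensor_of_isMonoidal] at h1 h2
  have h3 : Intertwines F (ε F) (tensorStr F (η.hom.app s) (η.hom.app s)) (η_ s s) (c * c) := by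
    unfold Intertwines at h2 ⊢
    rw [h2, one_smul, hc', tensorStr_smul_smul, Linear.comp_smul]
  exact Intertwines.scalar_eq (coevaluation_ne_zero (X := s) (Y := s)) h3 h1

/-- All tensor isomorphisms agree at `x`, as `x` occurs in the even tensor power `s ⊗ s`. -/
theorem app_x_eq [F.Additive] [F.IsEquivalence] [ExactPairing s s]
    (η η' : 𝟭 C ≅ F) [NatTrans.IsMonoidal η.hom]
    [NatTrans.IsMonoidal η'.hom] : η.hom.app x = η'.hom.app x := by
  have := h.simple_x
  obtain ⟨j, hj⟩ := h.exists_ne_zero_hom_x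
  have := mono_of_nonzero_from_simple hj
  have hss : η.hom.app (s ⊗ s) = η'.hom.app (s ⊗ s) := by
    rw [app_tensor_of_isMonoidal, app_tensor_of_isMonoidal]
    obtain ⟨r, hr, e⟩ := h.exists_app_s_eq_smul η η'
    rw [e, tensorStr_smul_smul, hr, one_smul]
  rw [← cancel_mono (F.map j), ← η.hom.naturality j, ← η'.hom.naturality j, hss]

/-- Tensor isomorphisms are determined by their value at `s`. -/
theorem app_eq_of_app_s_eq [F.Additive] [F.IsEquivalence] [ExactPairing s s] (η η' : 𝟭 C ≅ F)
    [NatTrans.IsMonoidal η.hom] [NatTrans.IsMonoidal η'.hom] (hs : η.hom.app s = η'.hom.app s) (X : C) :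
    η.hom.app X = η'.hom.app X := by
  have hS : ∀ i : Fin 3, η.hom.app (![𝟙_ C, x, s] i) = η'.hom.app (![𝟙_ C, x, s] i) :=
    fun i => match i with
      | 0 => (app_unit_of_isMonoidal η.hom).trans (app_unit_of_isMonoidal η'.hom).symm
      | 1 => h.app_x_eq η η'
      | 2 => hs
  obtain ⟨n, k, ι, π, ht⟩ := exists_resolution_of_exhaust _ h.simples_exhaust X
  refine eq_of_sum_comp_eq_id ht fun i => ?_
  have h1 := η.hom.naturality (ι i)
  have h2 := η'.hom.naturality (ι i)
  rw [hS] at h1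
  exact h1.trans h2.symm

variable [F.Additive] [F.Linear ℂ] [F.IsEquivalence]

/-- A tensor autoequivalence fixing the simple objects is isomorphic to the identity, by an
isomorphism with prescribed value at `s` subject only to respecting the pairing of `s` with
itself. -/
theorem exists_monoidal_iso [ExactPairing s s] (hx : Nonempty (x ≅ F.obj x)) (w : s ≅ F.obj s)
    (hw : Intertwines F (ε F) (tensorStr F w.hom w.hom) (η_ s s) 1) :
    ∃ η : 𝟭 C ≅ F, NatTrans.IsMonoidal η.hom ∧ η.hom.app s = w.hom := by
  obtain ⟨j, hj⟩ := h.exists_ne_zero_hom_x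
  obtain ⟨a, ha⟩ := h.exists_intertwines_x F hx hj w
  obtain ⟨m⟩ := h.x_square
  obtain ⟨η, hη⟩ := exists_natIso_of_simples ![𝟙_ C, x, s] h.simples h.simples_not_iso
    h.simples_exhaust F
    (fun i => match i with
      | 0 => Functor.Monoidal.εIso F
      | 1 => a
      | 2 => w)
  have h0 : η.hom.app (𝟙_ C) = ε F := hη 0
  have h1 : η.hom.app x = a.hom := hη 1
  have h2 : η.hom.app s = w.hom := hη 2
  have hleft : ∀ X, η.hom.app (𝟙_ C ⊗ X) = tensorStr F (η.hom.app (𝟙_ C)) (η.hom.app X) :=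
    fun X => app_tensor_eq_of_isIso (λ_ X).hom (by rw [h0]; exact Intertwines.leftUnitor)
  have hright : ∀ X, η.hom.app (X ⊗ 𝟙_ C) = tensorStr F (η.hom.app X) (η.hom.app (𝟙_ C)) :=
    fun X => app_tensor_eq_of_isIso (ρ_ X).hom (by rw [h0]; exact Intertwines.rightUnitor)
  have hxx : η.hom.app (x ⊗ x) = tensorStr F (η.hom.app x) (η.hom.app x) :=
    app_tensor_eq_of_isIso m.hom (by rw [h0, h1]; exact h.intertwines_square hw hj ha m)
  have hxs : η.hom.app (x ⊗ s) = tensorStr F (η.hom.app x) (η.hom.app s) :=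
    have := h.isIso_tensorRightHomEquiv_symm hj
    app_tensor_eq_of_isIso ((tensorRightHomEquiv x s s s).symm j)
      (by rw [h1, h2]; exact h.intertwines_left_action hw ha)
  have hsx : η.hom.app (s ⊗ x) = tensorStr F (η.hom.app s) (η.hom.app x) :=
    have := h.isIso_tensorLeftHomEquiv_symm hj
    app_tensor_eq_of_isIso ((tensorLeftHomEquiv x s s s).symm j)
      (by rw [h1, h2]; exact h.intertwines_right_action hw ha)
  have hss : η.hom.app (s ⊗ s) = tensorStr F (η.hom.app s) (η.hom.app s) := by
    have e : ∀ {A : C} (b : A ⟶ F.obj A) (g : A ⟶ s ⊗ s), η.hom.app A = b →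
        Intertwines F b (tensorStr F w.hom w.hom) g 1 →
        g ≫ η.hom.app (s ⊗ s) = g ≫ tensorStr F w.hom w.hom := by
      intro A b g hb hg
      rw [Intertwines, one_smul] at hg
      rw [← hg, ← hb]
      exact η.hom.naturality g
    rw [h2]
    exact h.tensor_ext hj (e _ _ h0 hw) (e _ _ h1 ha)
  refine ⟨η, ⟨?_, fun X Y => ?_⟩, h2⟩
  · rw [h0]
    exact Category.id_comp _
  · have := tensor_of_simples ![𝟙_ C, x, s] h.simples_exhaust F η.hom
      (fun i k => match i, k with
        | 0, _ => hleft _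
        | 1, 0 => hright _
        | 2, 0 => hright _
        | 1, 1 => hxx
        | 1, 2 => hxs
        | 2, 1 => hsx
        | 2, 2 => hss) X Y
    rw [this]
    exact Category.id_comp _

/-- The tensor automorphisms `±1` of the identity: the sign is the value at `s`. -/
theorem exists_monoidal_aut [ExactPairing s s] (r : ℂ) (hr : r * r = 1) :
    ∃ η : 𝟭 C ≅ 𝟭 C, NatTrans.IsMonoidal η.hom ∧ η.hom.app s = r • 𝟙 s :=
  h.exists_monoidal_iso (F := 𝟭 C) ⟨Iso.refl _⟩
    ⟨r • 𝟙 s, r • 𝟙 s, by simp [smul_smul, hr], by simp [smul_smul, hr]⟩ (by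
      simp [Intertwines, tensorStr, MonoidalCategory.tensorHom_def, smul_smul, hr])

end IsingFusion
end TensorIso

/-! ### Second cohomology with coefficients in `ℤ/2` -/

section Cohomology

variable {G : Type} [Group G]

/-- The value of a 2-cocycle, as an element of `ℤ/2`. -/
def cocycleVal (a : groupCohomology.cocycles₂ (Rep.trivial (ZMod 2) G (ZMod 2))) (g h : G) :
    ZMod 2 := a (g, h)

theorem cocycleVal_assoc (a : groupCohomology.cocycles₂ (Rep.trivial (ZMod 2) G (ZMod 2)))
    (g h j : G) :
    cocycleVal a g h + cocycleVal a (g * h) j = cocycleVal a h j + cocycleVal a g (h * j) :=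
  (add_comm _ _).trans ((groupCohomology.mem_cocycles₂_iff (a : G × G → _)).1 a.2 g h j)

/-- A 2-cocycle from a function. -/
def mkCocycle (b : G → G → ZMod 2)
    (hb : ∀ g h j, b g h + b (g * h) j = b h j + b g (h * j)) :
    groupCohomology.cocycles₂ (Rep.trivial (ZMod 2) G (ZMod 2)) :=
  ⟨fun p => b p.1 p.2, (groupCohomology.mem_cocycles₂_iff _).2 fun g h j =>
    (add_comm _ _).trans (hb g h j)⟩

theorem H2π_eq_iff_exists (a a' : groupCohomology.cocycles₂ (Rep.trivial (ZMod 2) G (ZMod 2))) :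
    groupCohomology.H2π _ a = groupCohomology.H2π _ a' ↔
      ∃ e : G → ZMod 2, ∀ g h, cocycleVal a g h + e (g * h) = e g + e h + cocycleVal a' g h := by
  rw [groupCohomology.H2π_eq_iff]
  constructor
  · rintro ⟨e, he⟩
    refine ⟨e, fun g h => ?_⟩
    have h1 : (e h : ZMod 2) - e (g * h) + e g = cocycleVal a g h - cocycleVal a' g h :=
      congrFun he (g, h)
    change cocycleVal a g h + (e (g * h) : ZMod 2) = (e g : ZMod 2) + e h + cocycleVal a' g h
    linear_combination -h1
  · rintro ⟨e, he⟩
    refine ⟨e, funext fun p => ?_⟩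
    change e p.2 - e (p.1 * p.2) + e p.1 = cocycleVal a p.1 p.2 - cocycleVal a' p.1 p.2
    linear_combination -he p.1 p.2

end Cohomology

/-! ### Monoidal functors from a group to a monoidal category of signs -/

section Signs

variable (M : Type*) [Category* M] [MonoidalCategory M]

/-- A monoidal category all of whose objects are isomorphic to the unit, the automorphism group of
the unit being `ℤ/2`: for every `X`, the morphisms `𝟙_ ⟶ X` form a torsor under `ℤ/2`. -/
structure SignStructure where
  sgn : ZMod 2 → (𝟙_ M ⟶ 𝟙_ M)
  sgn_add : ∀ a b, sgn (a + b) = sgn a ≫ sgn b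
  sgn_inj : ∀ a b, sgn a = sgn b → a = b
  nonempty : ∀ X : M, Nonempty (𝟙_ M ⟶ X)
  isIso : ∀ {X : M} (p : 𝟙_ M ⟶ X), IsIso p
  torsor : ∀ {X : M} (p q : 𝟙_ M ⟶ X), ∃ z, q = sgn z ≫ p

end Signs

section Composite

/-- Families of morphisms are compatible with the transport along equalities in `G`. -/
theorem comp_map_discrete {M : Type*} [Category* M] [MonoidalCategory M] {G : Type}
    (T : Discrete G ⥤ M) (u : ∀ g, 𝟙_ M ⟶ T.obj (Discrete.mk g)) {g h : G}
    (k : Discrete.mk g ⟶ Discrete.mk h) : u g ≫ T.map k = u h := by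
  obtain rfl : g = h := Discrete.eq_of_hom k
  obtain rfl : k = 𝟙 _ := Subsingleton.elim _ _
  simp

open Functor.LaxMonoidal

variable {M : Type*} [Category* M] [MonoidalCategory M] {G : Type} [Group G]

/-- The composite `id = id ⊗ id ⟶ T g ⊗ T h ⟶ T (g h)`. -/
def composite (T : Discrete G ⥤ M) [T.Monoidal] {g h : G} (p : 𝟙_ M ⟶ T.obj (Discrete.mk g))
    (q : 𝟙_ M ⟶ T.obj (Discrete.mk h)) : 𝟙_ M ⟶ T.obj (Discrete.mk (g * h)) :=
  (λ_ (𝟙_ M)).inv ≫ (p ⊗ₘ q) ≫ μ T (Discrete.mk g) (Discrete.mk h)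

theorem leftUnitor_inv_comp_tensorHom_end (a b : 𝟙_ M ⟶ 𝟙_ M) :
    (λ_ (𝟙_ M)).inv ≫ (a ⊗ₘ b) = (a ≫ b) ≫ (λ_ (𝟙_ M)).inv := by
  rw [MonoidalCategory.tensorHom_def, unitors_inv_equal, ← rightUnitor_inv_naturality_assoc,
    ← unitors_inv_equal, ← leftUnitor_inv_naturality, Category.assoc]

theorem composite_comp (T : Discrete G ⥤ M) [T.Monoidal] {g h : G}
    (p : 𝟙_ M ⟶ T.obj (Discrete.mk g)) (q : 𝟙_ M ⟶ T.obj (Discrete.mk h)) (a b : 𝟙_ M ⟶ 𝟙_ M) :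
    composite T (a ≫ p) (b ≫ q) = (a ≫ b) ≫ composite T p q := by
  unfold composite
  rw [← MonoidalCategory.tensorHom_comp_tensorHom, Category.assoc,
    reassoc_of% leftUnitor_inv_comp_tensorHom_end a b]
  simp only [Category.assoc]

theorem composite_assoc (T : Discrete G ⥤ M) [T.Monoidal] {g h k : G}
    (p : 𝟙_ M ⟶ T.obj (Discrete.mk g)) (q : 𝟙_ M ⟶ T.obj (Discrete.mk h))
    (r : 𝟙_ M ⟶ T.obj (Discrete.mk k)) :
    composite T (composite T p q) r ≫
        T.map (α_ (Discrete.mk g) (Discrete.mk h) (Discrete.mk k)).hom =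
      composite T p (composite T q r) := by
  have ha := Functor.LaxMonoidal.associativity T (Discrete.mk g) (Discrete.mk h) (Discrete.mk k)
  have h1 : ((λ_ (𝟙_ M)).inv ≫ (p ⊗ₘ q) ≫ μ T (Discrete.mk g) (Discrete.mk h)) ⊗ₘ r =
      (λ_ (𝟙_ M)).inv ▷ 𝟙_ M ≫ ((p ⊗ₘ q) ⊗ₘ r) ≫ μ T (Discrete.mk g) (Discrete.mk h) ▷ _ := by
    rw [← MonoidalCategory.tensorHom_id, ← MonoidalCategory.tensorHom_id,
      MonoidalCategory.tensorHom_comp_tensorHom, MonoidalCategory.tensorHom_comp_tensorHom,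
      Category.comp_id, Category.id_comp]
  have h2 : p ⊗ₘ ((λ_ (𝟙_ M)).inv ≫ (q ⊗ₘ r) ≫ μ T (Discrete.mk h) (Discrete.mk k)) =
      𝟙_ M ◁ (λ_ (𝟙_ M)).inv ≫ (p ⊗ₘ (q ⊗ₘ r)) ≫ _ ◁ μ T (Discrete.mk h) (Discrete.mk k) := by
    rw [← MonoidalCategory.id_tensorHom, ← MonoidalCategory.id_tensorHom,
      MonoidalCategory.tensorHom_comp_tensorHom, MonoidalCategory.tensorHom_comp_tensorHom,
      Category.comp_id, Category.id_comp]
  have h3 : (λ_ (𝟙_ M)).inv ≫ (λ_ (𝟙_ M)).inv ▷ 𝟙_ M ≫ (α_ (𝟙_ M) (𝟙_ M) (𝟙_ M)).hom =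
      (λ_ (𝟙_ M)).inv ≫ 𝟙_ M ◁ (λ_ (𝟙_ M)).inv := by monoidal
  calc _ = (λ_ (𝟙_ M)).inv ≫ (λ_ (𝟙_ M)).inv ▷ 𝟙_ M ≫ ((p ⊗ₘ q) ⊗ₘ r) ≫
        (μ T (Discrete.mk g) (Discrete.mk h) ▷ _ ≫ μ T _ (Discrete.mk k) ≫
          T.map (α_ (Discrete.mk g) (Discrete.mk h) (Discrete.mk k)).hom) := by
        unfold composite
        rw [h1]
        simp only [Category.assoc]
        rfl
    _ = ((λ_ (𝟙_ M)).inv ≫ (λ_ (𝟙_ M)).inv ▷ 𝟙_ M ≫ (α_ _ _ _).hom) ≫ (p ⊗ₘ (q ⊗ₘ r)) ≫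
        _ ◁ μ T (Discrete.mk h) (Discrete.mk k) ≫ μ T (Discrete.mk g) _ := by
        rw [ha, MonoidalCategory.associator_naturality_assoc]
        simp only [Category.assoc]
    _ = _ := by
        rw [h3]
        unfold composite
        rw [h2]
        simp only [Category.assoc]
        rfl

/-- The unit isomorphism of `T` is a left unit for `composite`. -/
theorem composite_ε (T : Discrete G ⥤ M) [T.Monoidal] {g : G}
    (q : 𝟙_ M ⟶ T.obj (Discrete.mk g)) :
    composite T (g := 1) (ε T) q ≫ T.map (λ_ (Discrete.mk g)).hom = q := by
  have h1 := Functor.LaxMonoidal.left_unitality T (Discrete.mk g)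
  calc _ = (λ_ (𝟙_ M)).inv ≫ 𝟙_ M ◁ q ≫ (ε T ▷ _ ≫ μ T (𝟙_ _) (Discrete.mk g) ≫
        T.map (λ_ (Discrete.mk g)).hom) := by
        unfold composite
        rw [MonoidalCategory.tensorHom_def']
        simp only [Category.assoc]
        rfl
    _ = q := by rw [← h1]; simp

theorem composite_naturality {T T' : Discrete G ⥤ M} [T.Monoidal] [T'.Monoidal] (e : T ⟶ T')
    [NatTrans.IsMonoidal e] {g h : G} (p : 𝟙_ M ⟶ T.obj (Discrete.mk g))
    (q : 𝟙_ M ⟶ T.obj (Discrete.mk h)) :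
    composite T' (p ≫ e.app _) (q ≫ e.app _) = composite T p q ≫ e.app _ := by
  have h1 := NatTrans.IsMonoidal.tensor (τ := e) (Discrete.mk g) (Discrete.mk h)
  unfold composite
  rw [← MonoidalCategory.tensorHom_comp_tensorHom]
  simp only [Category.assoc]
  rw [← h1]
  rfl

theorem composite_map {N : Type*} [Category* N] [MonoidalCategory N] (K : M ⥤ N) [K.Monoidal]
    (T : Discrete G ⥤ M) [T.Monoidal] {g h : G} (p : 𝟙_ M ⟶ T.obj (Discrete.mk g))
    (q : 𝟙_ M ⟶ T.obj (Discrete.mk h)) :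
    composite (T ⋙ K) (ε K ≫ K.map p) (ε K ≫ K.map q) = ε K ≫ K.map (composite T p q) := by
  have h1 : (λ_ (𝟙_ N)).inv ≫ (ε K ⊗ₘ ε K) ≫ μ K (𝟙_ M) (𝟙_ M) = ε K ≫ K.map (λ_ (𝟙_ M)).inv := by
    simp [Functor.LaxMonoidal.ε_tensorHom_comp_μ]
  unfold composite
  rw [Functor.LaxMonoidal.comp_μ]
  change _ ≫ (((ε K ≫ K.map p) ⊗ₘ (ε K ≫ K.map q)) : 𝟙_ N ⊗ 𝟙_ N ⟶ _) ≫ _ = _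
  rw [← MonoidalCategory.tensorHom_comp_tensorHom, Category.assoc,
    Functor.LaxMonoidal.μ_natural_assoc]
  simp only [K.map_comp]
  rw [← reassoc_of% h1]

end Composite

namespace SignStructure

open Functor.LaxMonoidal

variable {M : Type*} [Category* M] [MonoidalCategory M] {G : Type} [Group G] (S : SignStructure M)

/-- The monoidal functor `T` has class `β`: with respect to some trivializations `u g` of the
objects `T g`, its monoidal structure is given by a cocycle representing `β`. -/
def HasClass (T : Discrete G ⥤ M) [T.Monoidal] (β : H2Z2 G) : Prop :=
  ∃ (a : groupCohomology.cocycles₂ (Rep.trivial (ZMod 2) G (ZMod 2)))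
    (u : ∀ g : G, 𝟙_ M ⟶ T.obj (Discrete.mk g)), groupCohomology.H2π _ a = β ∧
    ∀ g h : G, composite T (u g) (u h) = S.sgn (cocycleVal a g h) ≫ u (g * h)

theorem sgn_zero : S.sgn 0 = 𝟙 _ := by
  have := S.isIso (S.sgn 0)
  rw [← cancel_mono (S.sgn 0), ← S.sgn_add, add_zero, Category.id_comp]

theorem sgn_comp_sgn_comp {X : M} (p : 𝟙_ M ⟶ X) (a b : ZMod 2) :
    S.sgn a ≫ S.sgn b ≫ p = S.sgn (a + b) ≫ p := by
  rw [S.sgn_add, Category.assoc]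

theorem sgn_comp_injective {X : M} (p : 𝟙_ M ⟶ X) {a b : ZMod 2}
    (h : S.sgn a ≫ p = S.sgn b ≫ p) : a = b := by
  have := S.isIso p
  exact S.sgn_inj _ _ ((cancel_mono p).1 h)

theorem composite_sgn (T : Discrete G ⥤ M) [T.Monoidal] {g h : G}
    (p : 𝟙_ M ⟶ T.obj (Discrete.mk g)) (q : 𝟙_ M ⟶ T.obj (Discrete.mk h)) (a b : ZMod 2) :
    composite T (S.sgn a ≫ p) (S.sgn b ≫ q) = S.sgn (a + b) ≫ composite T p q := by
  rw [composite_comp, S.sgn_add]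

theorem composite_sgn_left (T : Discrete G ⥤ M) [T.Monoidal] {g h : G}
    (p : 𝟙_ M ⟶ T.obj (Discrete.mk g)) (q : 𝟙_ M ⟶ T.obj (Discrete.mk h)) (a : ZMod 2) :
    composite T (S.sgn a ≫ p) q = S.sgn a ≫ composite T p q := by
  have := S.composite_sgn T p q a 0
  rwa [S.sgn_zero, Category.id_comp, add_zero] at this

theorem composite_sgn_right (T : Discrete G ⥤ M) [T.Monoidal] {g h : G}
    (p : 𝟙_ M ⟶ T.obj (Discrete.mk g)) (q : 𝟙_ M ⟶ T.obj (Discrete.mk h)) (a : ZMod 2) :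
    composite T p (S.sgn a ≫ q) = S.sgn a ≫ composite T p q := by
  have := S.composite_sgn T p q 0 a
  rwa [S.sgn_zero, Category.id_comp, zero_add] at this

/-- The cocycle identity is the associativity of the monoidal structure. -/
theorem exists_hasClass (T : Discrete G ⥤ M) [T.Monoidal] : ∃ β, S.HasClass T β := by
  let u : ∀ g : G, 𝟙_ M ⟶ T.obj (Discrete.mk g) := fun g => (S.nonempty _).some
  choose b hb using fun g h => S.torsor (u (g * h)) (composite T (u g) (u h))
  refine ⟨_, mkCocycle b fun g h k => ?_, u, rfl, hb⟩
  have h1 := composite_assoc T (u g) (u h) (u k)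
  rw [hb g h, hb h k, composite_sgn_left, composite_sgn_right, hb (g * h) k, hb g (h * k),
    sgn_comp_sgn_comp, sgn_comp_sgn_comp, Category.assoc] at h1
  refine S.sgn_comp_injective (u (g * (h * k))) (Eq.trans ?_ h1)
  congr 1
  exact (comp_map_discrete T u _).symm

/-- The unit isomorphism is determined by the tensor structure, since `ε` is neutral for
`composite`. -/
theorem ε_eq {T : Discrete G ⥤ M} [T.Monoidal]
    {a : groupCohomology.cocycles₂ (Rep.trivial (ZMod 2) G (ZMod 2))}
    {u : ∀ g : G, 𝟙_ M ⟶ T.obj (Discrete.mk g)}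
    (hu : ∀ g h : G, composite T (u g) (u h) = S.sgn (cocycleVal a g h) ≫ u (g * h)) :
    ε T = S.sgn (cocycleVal a 1 1) ≫ u 1 := by
  obtain ⟨z, hz⟩ := S.torsor (u 1) (ε T)
  have h1 := composite_ε T (u 1)
  rw [hz, composite_sgn_left, hu, sgn_comp_sgn_comp, Category.assoc] at h1
  have h2 : S.sgn (z + cocycleVal a 1 1) ≫ u 1 = S.sgn 0 ≫ u 1 := by
    rw [S.sgn_zero, Category.id_comp]
    refine Eq.trans ?_ h1
    congr 1
    exact (comp_map_discrete T u _).symm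
  have h3 := S.sgn_comp_injective (u 1) h2
  rw [hz, ← CharTwo.add_eq_zero.1 h3]

theorem HasClass.of_iso {T T' : Discrete G ⥤ M} [T.Monoidal] [T'.Monoidal] (e : T ⟶ T')
    [NatTrans.IsMonoidal e] {β : H2Z2 G} (h : S.HasClass T β) : S.HasClass T' β := by
  obtain ⟨a, u, ha, hu⟩ := h
  refine ⟨a, fun g => u g ≫ e.app _, ha, fun g h => ?_⟩
  rw [composite_naturality, hu, Category.assoc]

/-- Functors of the same class are isomorphic: after changing the trivializations by a cochain the
cocycles coincide, and comparing trivializations is then monoidal. -/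
theorem exists_iso_of_hasClass {T T' : Discrete G ⥤ M} [T.Monoidal] [T'.Monoidal] {β : H2Z2 G}
    (h : S.HasClass T β) (h' : S.HasClass T' β) : ∃ e : T ≅ T', NatTrans.IsMonoidal e.hom := by
  obtain ⟨a, u, ha, hu⟩ := h
  obtain ⟨a', u', ha', hu'⟩ := h'
  obtain ⟨e, he⟩ := (H2π_eq_iff_exists a a').1 (ha.trans ha'.symm)
  let v : ∀ g : G, 𝟙_ M ⟶ T'.obj (Discrete.mk g) := fun g => S.sgn (e g) ≫ u' g
  have hv : ∀ g h : G, composite T' (v g) (v h) = S.sgn (cocycleVal a g h) ≫ v (g * h) := by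
    intro g h
    rw [composite_sgn, hu', sgn_comp_sgn_comp, sgn_comp_sgn_comp, he]
  have := fun g => S.isIso (u g)
  have := fun g => S.isIso (v g)
  refine ⟨Discrete.natIso fun X => (asIso (u X.as)).symm ≪≫ asIso (v X.as), ⟨?_, ?_⟩⟩
  · change ε T ≫ inv (u 1) ≫ v 1 = ε T'
    rw [S.ε_eq hu, S.ε_eq hv, Category.assoc, IsIso.hom_inv_id_assoc]
  · rintro ⟨g⟩ ⟨h⟩
    change μ T _ _ ≫ inv (u (g * h)) ≫ v (g * h) =
      ((inv (u g) ≫ v g) ⊗ₘ (inv (u h) ≫ v h)) ≫ μ T' _ _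
    have h1 := hu g h
    have h2 := hv g h
    unfold composite at h1 h2
    rw [← cancel_epi (u g ⊗ₘ u h), ← cancel_epi (λ_ (𝟙_ M)).inv, ← Category.assoc (u g ⊗ₘ u h),
      ← Category.assoc (λ_ (𝟙_ M)).inv, h1, MonoidalCategory.tensorHom_comp_tensorHom_assoc,
      IsIso.hom_inv_id_assoc, IsIso.hom_inv_id_assoc, h2, Category.assoc,
      IsIso.hom_inv_id_assoc]

/-- Every class is realized, by a functor sending all group elements to the unit. -/
theorem exists_functor (β : H2Z2 G) : ∃ (T : Discrete G ⥤ M) (_ : T.Monoidal), S.HasClass T β := by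
  induction β using groupCohomology.H2_induction_on with | _ a
  let i : ZMod 2 → (𝟙_ M ≅ 𝟙_ M) := fun z => @asIso _ _ _ _ (S.sgn z) (S.isIso _)
  have hi : ∀ z, (i z).hom = S.sgn z := fun _ => rfl
  have hone : ∀ g, cocycleVal a 1 g = cocycleVal a 1 1 := fun g =>
    groupCohomology.cocycles₂_map_one_fst a g
  have hone' : ∀ g, cocycleVal a g 1 = cocycleVal a 1 1 := fun g =>
    groupCohomology.cocycles₂_map_one_snd a g
  have he : (ρ_ (𝟙_ M)).inv ≫ (λ_ (𝟙_ M)).hom = 𝟙 _ := by rw [unitors_equal]; simp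
  have he' : (λ_ (𝟙_ M)).inv ≫ (ρ_ (𝟙_ M)).hom = 𝟙 _ := by rw [← unitors_equal]; simp
  have hassoc : (ρ_ (𝟙_ M ⊗ 𝟙_ M)).hom = (α_ (𝟙_ M) (𝟙_ M) (𝟙_ M)).hom ≫
      (λ_ (𝟙_ M ⊗ 𝟙_ M)).hom := by monoidal
  let c : ((Functor.const (Discrete G)).obj (𝟙_ M)).CoreMonoidal :=
    { εIso := i (cocycleVal a 1 1)
      μIso := fun g h => λ_ (𝟙_ M) ≪≫ i (cocycleVal a g.as h.as)
      μIso_hom_natural_left := by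
        rintro ⟨g⟩ ⟨h⟩ k l
        obtain rfl : g = h := Discrete.eq_of_hom k
        simp
      μIso_hom_natural_right := by
        rintro ⟨g⟩ ⟨h⟩ k l
        obtain rfl : g = h := Discrete.eq_of_hom l
        simp
      associativity := by
        rintro ⟨g⟩ ⟨h⟩ ⟨k⟩
        have h1 := cocycleVal_assoc a g h k
        have h2 : S.sgn (cocycleVal a g h) ≫ S.sgn (cocycleVal a (g * h) k) =
            S.sgn (cocycleVal a h k) ≫ S.sgn (cocycleVal a g (h * k)) := by
          rw [← S.sgn_add, ← S.sgn_add, h1]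
        simp [hi, hassoc, reassoc_of% he, h2]
      left_unitality := by
        rintro ⟨g⟩
        have h2 : S.sgn (cocycleVal a 1 1) ≫ S.sgn (cocycleVal a 1 g) = 𝟙 _ := by
          rw [← S.sgn_add, hone g, CharTwo.add_self_eq_zero, S.sgn_zero]
        simp [hi, h2, unitors_equal]
      right_unitality := by
        rintro ⟨g⟩
        have h2 : S.sgn (cocycleVal a 1 1) ≫ S.sgn (cocycleVal a g 1) = 𝟙 _ := by
          rw [← S.sgn_add, hone' g, CharTwo.add_self_eq_zero, S.sgn_zero]
        simp [hi, reassoc_of% he', h2, unitors_equal] }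
  refine ⟨_, c.toMonoidal, a, fun _ => 𝟙 _, rfl, fun g h => ?_⟩
  change (λ_ (𝟙_ M)).inv ≫ (𝟙 (𝟙_ M) ⊗ₘ 𝟙 (𝟙_ M)) ≫ (λ_ (𝟙_ M)).hom ≫
    S.sgn (cocycleVal a g h) = _
  simp

end SignStructure

/-! ### The class of an action at an object -/

section ClassAt

open Functor.LaxMonoidal

/-- The sign `(-1) ^ z`. -/
def zsign (z : ZMod 2) : ℂ := (-1) ^ ZMod.val z

theorem zsign_zero : zsign 0 = 1 := by simp [zsign]

theorem zsign_one : zsign 1 = -1 := by simp [zsign, ZMod.val_one]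

theorem zsign_cases {P : ZMod 2 → Prop} (h0 : P 0) (h1 : P 1) (z : ZMod 2) : P z := by
  fin_cases z
  exacts [h0, h1]

theorem zsign_add (a b : ZMod 2) : zsign (a + b) = zsign a * zsign b := by
  have h2 : (1 : ZMod 2) + 1 = 0 := by decide
  induction a using zsign_cases <;> induction b using zsign_cases <;>
    simp [zsign_zero, zsign_one, h2]

theorem zsign_mul_self (a : ZMod 2) : zsign a * zsign a = 1 := by
  rw [← zsign_add, CharTwo.add_self_eq_zero, zsign_zero]

theorem zsign_injective : Function.Injective zsign := by
  intro a b
  induction a using zsign_cases <;> induction b using zsign_cases <;>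
    norm_num [zsign_zero, zsign_one]

theorem exists_zsign {r : ℂ} (hr : r * r = 1) : ∃ z, zsign z = r := by
  rcases mul_self_eq_one_iff.1 hr with rfl | rfl
  exacts [⟨0, zsign_zero⟩, ⟨1, zsign_one⟩]

namespace TensorAut

variable {D : Type u} [Category.{v} D] [Preadditive D] [Linear ℂ D] [MonoidalCategory D]

/-- The inverse of a tensor natural isomorphism. -/
def Hom.symm {F G : TensorAut D} (a : F ⟶ G) : G ⟶ F :=
  ⟨(Hom.iso a).symm, inferInstanceAs (NatTrans.IsMonoidal (Hom.iso a).inv)⟩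

theorem comp_symm {F G : TensorAut D} (a : F ⟶ G) : a ≫ Hom.symm a = 𝟙 F :=
  hom_ext fun X => (Hom.iso a).hom_inv_id_app X

theorem symm_comp {F G : TensorAut D} (a : F ⟶ G) : Hom.symm a ≫ a = 𝟙 G :=
  hom_ext fun X => (Hom.iso a).inv_hom_id_app X

instance {F G : TensorAut D} (a : F ⟶ G) : IsIso a := ⟨Hom.symm a, comp_symm a, symm_comp a⟩

theorem comp_app_of_eq_smul {F : TensorAut D} (a : 𝟙_ (TensorAut D) ⟶ 𝟙_ (TensorAut D))
    (q : 𝟙_ (TensorAut D) ⟶ F) {X : D} {r : ℂ} (ha : Hom.app a X = r • 𝟙 X) :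
    Hom.app (a ≫ q) X = r • Hom.app q X := by
  rw [comp_app, ha]
  exact (Linear.smul_comp _ _ _ _ _ _).trans (congrArg _ (Category.id_comp _))

theorem composite_app {G : Type} [Group G] (T : Discrete G ⥤ TensorAut D) [T.Monoidal] {g h : G}
    (p : 𝟙_ (TensorAut D) ⟶ T.obj (Discrete.mk g)) (q : 𝟙_ (TensorAut D) ⟶ T.obj (Discrete.mk h))
    (X : D) :
    Hom.app (composite T p q) X = Hom.app p X ≫ (T.obj (Discrete.mk g)).F.map (Hom.app q X) ≫
      Hom.app (μ T (Discrete.mk g) (Discrete.mk h)) X := by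
  unfold composite
  rw [comp_app, comp_app, tensorHom_app, leftUnitor_inv_app]
  rw [app_naturality, Category.assoc]
  exact Category.id_comp _

theorem composite_app_smul {G : Type} [Group G] (T : Discrete G ⥤ TensorAut D) [T.Monoidal]
    {g h : G} {p p' : 𝟙_ (TensorAut D) ⟶ T.obj (Discrete.mk g)}
    {q q' : 𝟙_ (TensorAut D) ⟶ T.obj (Discrete.mk h)} {X : D} {r t : ℂ}
    (hp : Hom.app p' X = r • Hom.app p X) (hq : Hom.app q' X = t • Hom.app q X) :
    Hom.app (composite T p' q') X = (r * t) • Hom.app (composite T p q) X := by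
  rw [composite_app, composite_app, hp, hq, Functor.map_smul]
  simp only [Linear.smul_comp, Linear.comp_smul, smul_smul, mul_comm t r]

end TensorAut

variable {D : Type u} [Category.{v} D] [Preadditive D] [Linear ℂ D] [MonoidalCategory D]
  {G : Type} [Group G]

theorem hasClassAt_iff {T : Discrete G ⥤ TensorAut D} [T.Monoidal] {X : D} {α : H2Z2 G} :
    HasClassAt T X α ↔
      ∃ (a : groupCohomology.cocycles₂ (Rep.trivial (ZMod 2) G (ZMod 2)))
        (u : ∀ g : G, 𝟙_ (TensorAut D) ⟶ T.obj (Discrete.mk g)), groupCohomology.H2π _ a = α ∧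
        ∀ g h : G, TensorAut.Hom.app (composite T (u g) (u h)) X =
          zsign (cocycleVal a g h) • TensorAut.Hom.app (u (g * h)) X := Iff.rfl

theorem HasClassAt.of_iso {T : Discrete G ⥤ TensorAut D} [T.Monoidal] {X Y : D} {α : H2Z2 G}
    (i : X ≅ Y) (h : HasClassAt T X α) : HasClassAt T Y α := by
  obtain ⟨a, u, ha, hu⟩ := hasClassAt_iff.1 h
  refine hasClassAt_iff.2 ⟨a, u, ha, fun g h => ?_⟩
  have key : ∀ {F : TensorAut D} (p : 𝟙_ (TensorAut D) ⟶ F),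
      i.hom ≫ TensorAut.Hom.app p Y = TensorAut.Hom.app p X ≫ F.F.map i.hom :=
    fun p => TensorAut.app_naturality p i.hom
  have h1 := key (composite T (u g) (u h))
  have h2 := key (u (g * h))
  refine (cancel_epi i.hom).1 (h1.trans ?_)
  rw [hu, Linear.smul_comp]
  exact (congrArg _ h2.symm).trans (Linear.comp_smul _ _ _ i.hom _ _).symm

/-- The class of an action at an object is unique as soon as the tensor automorphisms of the
identity act on this object by signs. -/
theorem HasClassAt.unique {T : Discrete G ⥤ TensorAut D} [T.Monoidal] {X : D} (hX : 𝟙 X ≠ 0)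
    (haut : ∀ a : 𝟙_ (TensorAut D) ⟶ 𝟙_ (TensorAut D), ∃ z, TensorAut.Hom.app a X = zsign z • 𝟙 X)
    {α α' : H2Z2 G} (h : HasClassAt T X α) (h' : HasClassAt T X α') : α = α' := by
  obtain ⟨a, u, rfl, hu⟩ := hasClassAt_iff.1 h
  obtain ⟨a', u', rfl, hu'⟩ := hasClassAt_iff.1 h'
  have hex : ∀ g, ∃ z, TensorAut.Hom.app (u' g) X = zsign z • TensorAut.Hom.app (u g) X := by
    intro g
    obtain ⟨z, hz⟩ := haut (u' g ≫ inv (u g))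
    refine ⟨z, ?_⟩
    have h1 : u' g = (u' g ≫ inv (u g)) ≫ u g := by simp
    rw [h1, TensorAut.comp_app_of_eq_smul _ _ hz]
  choose e he using hex
  refine (H2π_eq_iff_exists a a').2 ⟨e, fun g h => zsign_injective ?_⟩
  have h1 := hu' g h
  rw [TensorAut.composite_app_smul T (he g) (he h), hu, he, smul_smul, smul_smul] at h1
  have hne : TensorAut.Hom.app (u (g * h)) X ≠ 0 := fun h0 => hX (by
    have h2 := congrArg (fun t => TensorAut.Hom.app t X) (IsIso.hom_inv_id (u (g * h)))
    rw [TensorAut.comp_app, h0, zero_comp] at h2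
    exact h2.symm)
  have h3 : zsign (e g) * zsign (e h) * zsign (cocycleVal a g h) =
      zsign (cocycleVal a' g h) * zsign (e (g * h)) :=
    smul_left_injective ℂ hne h1
  have h5 : ∀ x y z w v : ℂ, x * x = 1 → y * y = 1 → v * v = 1 → x * y * z = w * v →
      z * v = x * y * w := by
    intro x y z w v hx hy hv hxy
    calc z * v = (x * x) * (y * y) * (z * v) := by rw [hx, hy]; ring
      _ = x * y * (x * y * z) * v := by ring
      _ = x * y * w * (v * v) := by rw [hxy]; ring
      _ = x * y * w := by rw [hv, mul_one]
  rw [zsign_add, zsign_add, zsign_add]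
  exact h5 _ _ _ _ _ (zsign_mul_self _) (zsign_mul_self _) (zsign_mul_self _) h3

/-- On an object of order two with scalar endomorphisms, tensor automorphisms of the identity are
signs. -/
theorem exists_app_eq_zsign_of_square [MonoidalPreadditive D] [MonoidalLinear ℂ D] {X : D}
    (hX : ∀ g : X ⟶ X, ∃ c : ℂ, g = c • 𝟙 X) (m : X ⊗ X ≅ 𝟙_ D) (h1 : 𝟙 (𝟙_ D) ≠ 0)
    (a : 𝟙_ (TensorAut D) ⟶ 𝟙_ (TensorAut D)) :
    ∃ z, TensorAut.Hom.app a X = zsign z • 𝟙 X := by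
  obtain ⟨c, hc⟩ := hX (TensorAut.Hom.app a X)
  suffices h : c * c = 1 by
    obtain ⟨z, rfl⟩ := exists_zsign h
    exact ⟨z, hc⟩
  have hm : NatTrans.IsMonoidal (F₁ := 𝟭 D) (F₂ := 𝟭 D) a.iso.hom := a.isMonoidal
  have e0 : a.iso.hom.app (𝟙_ D) = 𝟙 (𝟙_ D) := app_unit_of_isMonoidal (F := 𝟭 D) a.iso.hom
  have e1 : a.iso.hom.app (X ⊗ X) =
      tensorStr (𝟭 D) (TensorAut.Hom.app a X) (TensorAut.Hom.app a X) :=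
    app_tensor_of_isMonoidal (F := 𝟭 D) a.iso.hom X X
  have e2 : m.hom ≫ a.iso.hom.app (𝟙_ D) = a.iso.hom.app (X ⊗ X) ≫ m.hom :=
    a.iso.hom.naturality m.hom
  have e3 : tensorStr (𝟭 D) (TensorAut.Hom.app a X) (TensorAut.Hom.app a X) =
      (c * c) • 𝟙 (X ⊗ X) := by
    rw [hc]
    refine (tensorStr_smul_smul (F := 𝟭 D) (𝟙 X) (𝟙 X) c).trans ?_
    simp [tensorStr]
  have e4 : m.hom = (c * c) • m.hom := by
    rw [e0, e1, e3] at e2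
    exact (Category.comp_id _).symm.trans
      (e2.trans ((Linear.smul_comp _ _ _ _ _ _).trans (congrArg _ (Category.id_comp _))))
  have hm0 : m.hom ≠ 0 := fun h0 => h1 (by rw [← m.inv_hom_id, h0, comp_zero])
  exact smul_left_injective ℂ hm0 (e4.symm.trans (one_smul ℂ m.hom).symm)

end ClassAt

/-! ### Fermionic actions on an Ising category -/

section FermionObject

open Functor.LaxMonoidal

variable {C : Type u} [Category.{v} C] [Preadditive C] [MonoidalCategory C]

theorem Fermion.tensor_self_iso (f : Fermion C) : Nonempty (f.X ⊗ f.X ≅ 𝟙_ C) :=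
  f.square.map (Center.forget C).mapIso

/-- A fermion is not the unit object, which has trivial self-braiding. -/
theorem Fermion.not_iso_unit [BraidedCategory C] [MonoidalPreadditive C] [Linear ℂ C]
    (f : Fermion C) (hf : f.IsSpinBraided) (h1 : 𝟙 (𝟙_ C) ≠ 0) : ¬ Nonempty (f.X ≅ 𝟙_ C) := by
  rintro ⟨e⟩
  have hnat := f.σ_naturality e.hom
  have hself : (f.σ f.X).hom = -𝟙 (f.X ⊗ f.X) := f.self
  rw [hself, hf, braiding_tensorUnit_left] at hnat
  have hA : e.hom ▷ f.X ≫ (λ_ f.X).hom = f.X ◁ e.hom ≫ (ρ_ f.X).hom := by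
    rw [← cancel_mono e.hom]
    simp only [Category.assoc]
    rw [← leftUnitor_naturality, ← rightUnitor_naturality, unitors_equal, whisker_exchange_assoc]
  have hB : f.X ◁ e.hom = -(f.X ◁ e.hom) := by
    rw [reassoc_of% hA, Iso.hom_inv_id, Category.comp_id] at hnat
    simpa using hnat
  have hC : f.X ◁ e.hom = 0 := by
    have h2 : (2 : ℂ) • (f.X ◁ e.hom) = 0 := by
      rw [two_smul]; nth_rewrite 1 [hB]; simp
    simpa using h2
  have hD : 𝟙 (f.X ⊗ f.X) = 0 := by
    rw [← MonoidalCategory.whiskerLeft_id, ← e.hom_inv_id, MonoidalCategory.whiskerLeft_comp, hC,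
      zero_comp]
  obtain ⟨m⟩ := f.tensor_self_iso
  exact h1 (by rw [← m.inv_hom_id, ← Category.id_comp m.hom, hD, zero_comp, comp_zero])

theorem composite_ι_app [Linear ℂ C] {f : Fermion C} {G : Type} [Group G]
    (T : Discrete G ⥤ f.FermionicAut) [T.Monoidal] {g h : G} (p : 𝟙_ f.FermionicAut ⟶ T.obj (Discrete.mk g))
    (q : 𝟙_ f.FermionicAut ⟶ T.obj (Discrete.mk h)) (X : C) :
    TensorAut.Hom.app (composite (T ⋙ f.fermionic.ι) p.hom q.hom) X =
      TensorAut.Hom.app (composite T p q).hom X := by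
  have h1 := composite_map f.fermionic.ι T p q
  have h2 : ∀ {F : f.FermionicAut} (r : 𝟙_ f.FermionicAut ⟶ F),
      ε f.fermionic.ι ≫ f.fermionic.ι.map r = r.hom := fun r => Category.id_comp _
  rw [h2, h2, h2] at h1
  rw [h1]

end FermionObject

section Action

open Functor.LaxMonoidal

variable {C : Type u} [Category.{v} C] [Abelian C] [Linear ℂ C] [MonoidalCategory C]
    [MonoidalPreadditive C] [MonoidalLinear ℂ C] [RigidCategory C] [IsFusionCategory C]
    {f : Fermion C} {s : C}

/-- A trivialization of a fermionic autoequivalence is determined by its value at `s`. -/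
theorem fermionicAut_hom_ext [ExactPairing s s] (h : IsingFusion f.X s) {F : f.FermionicAut}
    (p q : 𝟙_ f.FermionicAut ⟶ F)
    (hs : TensorAut.Hom.app p.hom s = TensorAut.Hom.app q.hom s) : p = q := by
  have hp : NatTrans.IsMonoidal (F₁ := 𝟭 C) p.hom.iso.hom := p.hom.isMonoidal
  have hq : NatTrans.IsMonoidal (F₁ := 𝟭 C) q.hom.iso.hom := q.hom.isMonoidal
  exact ObjectProperty.hom_ext _ (TensorAut.hom_ext fun X =>
    h.app_eq_of_app_s_eq (F := F.obj.F) p.hom.iso q.hom.iso hs X)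

theorem fermionicAut_hom_app_s [ExactPairing s s] (h : IsingFusion f.X s) {F : f.FermionicAut}
    (p q : 𝟙_ f.FermionicAut ⟶ F) :
    ∃ z, TensorAut.Hom.app q.hom s = zsign z • TensorAut.Hom.app p.hom s := by
  have hp : NatTrans.IsMonoidal (F₁ := 𝟭 C) p.hom.iso.hom := p.hom.isMonoidal
  have hq : NatTrans.IsMonoidal (F₁ := 𝟭 C) q.hom.iso.hom := q.hom.isMonoidal
  obtain ⟨r, hr, h'⟩ := h.exists_app_s_eq_smul (F := F.obj.F) p.hom.iso q.hom.iso
  obtain ⟨z, rfl⟩ := exists_zsign hr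
  exact ⟨z, h'⟩

theorem fermionicAut_hom_app_x [ExactPairing s s] (h : IsingFusion f.X s) {F : f.FermionicAut}
    (p q : 𝟙_ f.FermionicAut ⟶ F) :
    TensorAut.Hom.app q.hom f.X = TensorAut.Hom.app p.hom f.X := by
  have hp : NatTrans.IsMonoidal (F₁ := 𝟭 C) p.hom.iso.hom := p.hom.isMonoidal
  have hq : NatTrans.IsMonoidal (F₁ := 𝟭 C) q.hom.iso.hom := q.hom.isMonoidal
  exact h.app_x_eq (F := F.obj.F) q.hom.iso p.hom.iso

theorem exists_fermionicAut_hom [BraidedCategory C] [ExactPairing s s]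
    (h : IsingFusion f.X s) (hs : ¬ IsInvertibleObj s) (F : f.FermionicAut) : Nonempty (𝟙_ f.FermionicAut ⟶ F) := by
  obtain ⟨φ, -⟩ := F.property
  obtain ⟨w, hw⟩ := h.exists_intertwines_coevaluation F.obj.F (h.iso_obj_s F.obj.F hs)
  obtain ⟨η, hη, -⟩ := h.exists_monoidal_iso ⟨φ.symm⟩ w hw
  exact ⟨ObjectProperty.homMk ⟨η, hη⟩⟩

/-- The monoidal category of fermionic autoequivalences is a category of signs, the sign being the
value at `s`. -/
theorem exists_signStructure [BraidedCategory C] [ExactPairing s s] (h : IsingFusion f.X s)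
    (hs : ¬ IsInvertibleObj s) :
    ∃ S : SignStructure f.FermionicAut, ∀ z,
      TensorAut.Hom.app (S.sgn z).hom s = zsign z • 𝟙 s := by
  have := h.simple_s
  have hex : ∀ z, ∃ p : 𝟙_ f.FermionicAut ⟶ 𝟙_ f.FermionicAut,
      TensorAut.Hom.app p.hom s = zsign z • 𝟙 s := by
    intro z
    obtain ⟨η, hη, hηs⟩ := h.exists_monoidal_aut (zsign z) (zsign_mul_self z)
    exact ⟨ObjectProperty.homMk ⟨η, hη⟩, hηs⟩
  choose p hp using hex
  have hcomp : ∀ {F : f.FermionicAut} (q : 𝟙_ f.FermionicAut ⟶ F) (z),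
      TensorAut.Hom.app (p z ≫ q).hom s = zsign z • TensorAut.Hom.app q.hom s :=
    fun q z => TensorAut.comp_app_of_eq_smul (p z).hom q.hom (hp z)
  refine ⟨⟨p, fun a b => ?_, fun a b hab => ?_, fun F => exists_fermionicAut_hom h hs F,
    fun {F} q => ?_, fun {F} q r => ?_⟩, hp⟩
  · refine fermionicAut_hom_ext h _ _ ?_
    rw [hcomp, hp, hp, zsign_add, mul_smul]
  · have h1 := (hp a).symm.trans ((congrArg (fun t => TensorAut.Hom.app t.hom s) hab).trans (hp b))
    exact zsign_injective (smul_left_injective ℂ (id_nonzero s) h1)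
  · exact ⟨ObjectProperty.homMk (TensorAut.Hom.symm q.hom),
      ObjectProperty.hom_ext _ (TensorAut.comp_symm q.hom),
      ObjectProperty.hom_ext _ (TensorAut.symm_comp q.hom)⟩
  · obtain ⟨z, hz⟩ := fermionicAut_hom_app_s h r q
    obtain ⟨z', hz'⟩ := fermionicAut_hom_app_s h q r
    exact ⟨z', fermionicAut_hom_ext h _ _ (by rw [hcomp, hz'])⟩

variable {G : Type} [Group G] (T : Discrete G ⥤ f.FermionicAut) [T.Monoidal]

theorem hasClassAt_iff_hasClass [ExactPairing s s] (h : IsingFusion f.X s)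
    (S : SignStructure f.FermionicAut)
    (hS : ∀ z, TensorAut.Hom.app (S.sgn z).hom s = zsign z • 𝟙 s) (β : H2Z2 G) :
    HasClassAt (T ⋙ f.fermionic.ι) s β ↔ S.HasClass T β := by
  have hcomp : ∀ {F : f.FermionicAut} (q : 𝟙_ f.FermionicAut ⟶ F) (z),
      TensorAut.Hom.app (S.sgn z ≫ q).hom s = zsign z • TensorAut.Hom.app q.hom s :=
    fun q z => TensorAut.comp_app_of_eq_smul (S.sgn z).hom q.hom (hS z)
  rw [hasClassAt_iff]
  constructor
  · rintro ⟨a, u, ha, hu⟩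
    let p : ∀ g, 𝟙_ f.FermionicAut ⟶ T.obj (Discrete.mk g) := fun g => ObjectProperty.homMk (u g)
    refine ⟨a, p, ha, fun g k => fermionicAut_hom_ext h _ _ ?_⟩
    rw [hcomp, ← composite_ι_app]
    exact hu g k
  · rintro ⟨a, p, ha, hp⟩
    refine ⟨a, fun g => (p g).hom, ha, fun g k => ?_⟩
    rw [composite_ι_app, hp, hcomp]

/-- An action of a group by fermionic autoequivalences restricts to the trivial class on the
fermion, where all tensor isomorphisms agree. -/
theorem hasClassAt_rest_zero [ExactPairing s s] (h : IsingFusion f.X s)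
    (S : SignStructure f.FermionicAut) : HasClassAt (T ⋙ f.rest) f.genObj (0 : H2Z2 G) := by
  let u : ∀ g : G, 𝟙_ f.FermionicAut ⟶ T.obj (Discrete.mk g) := fun g => (S.nonempty _).some
  have h2 : ∀ {F : f.FermionicAut} (r : 𝟙_ f.FermionicAut ⟶ F),
      (TensorAut.Hom.app (ε f.rest ≫ f.rest.map r) f.genObj).hom = TensorAut.Hom.app r.hom f.X :=
    fun r => Category.id_comp _
  refine hasClassAt_iff.2 ⟨0, fun g => ε f.rest ≫ f.rest.map (u g), map_zero _, fun g k => ?_⟩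
  have hz : cocycleVal (0 : groupCohomology.cocycles₂ (Rep.trivial (ZMod 2) G (ZMod 2))) g k = 0 :=
    rfl
  rw [hz, zsign_zero, one_smul, composite_map]
  refine ObjectProperty.hom_ext _ ?_
  refine (h2 _).trans (Eq.trans ?_ (h2 _).symm)
  exact fermionicAut_hom_app_x h _ _

/-- Only the trivial super-group acts: the class at the fermion is unique, as tensor automorphisms of
the identity on the subcategory it generates are signs there, and `0` is such a class. -/
theorem eq_zero_of_hasClassAt_rest {α : H2Z2 G} [ExactPairing s s]
    (h : IsingFusion f.X s) (S : SignStructure f.FermionicAut)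
    (hα : HasClassAt (T ⋙ f.rest) f.genObj α) : α = 0 := by
  have h1 : Simple (𝟙_ C) := h.simple_unit
  have hx : Simple f.X := h.simple_x
  obtain ⟨m⟩ := f.tensor_self_iso
  refine HasClassAt.unique (fun h0 => id_nonzero f.X ?_) (fun a => ?_) hα
    (hasClassAt_rest_zero T h S)
  · exact congrArg (fun t => t.hom) h0
  · refine exists_app_eq_zsign_of_square (fun g => ?_) (f.gen.isoMk m) (fun h0 => ?_) a
    · obtain ⟨c, hc⟩ := exists_smul_id (S := f.X) g.hom
      exact ⟨c, ObjectProperty.hom_ext _ hc⟩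
    · exact id_nonzero (𝟙_ C) (congrArg (fun t => t.hom) h0)

end Action

theorem mainTheorem4 {C : Type u} [Category.{v} C] [Abelian C] [Linear ℂ C] [MonoidalCategory C]
    [MonoidalPreadditive C] [MonoidalLinear ℂ C] [RigidCategory C] [BraidedCategory C]
    [IsFusionCategory C] (hC : IsIsing C) (f : Fermion C) (hf : f.IsSpinBraided)
    (G : Type) [Group G] [Finite G] :
    (∀ α : H2Z2 G, Nonempty (FermionicAction f G α) ↔ α = 0) ∧
    ∃ e : FermionicAction.Classes f G 0 ≃ H2Z2 G,
      ∀ (T : FermionicAction f G 0) (s : C), Simple s → ¬ IsInvertibleObj s →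
        ∀ β : H2Z2 G, e T.toClass = β ↔ HasClassAt T.bosonic s β := by
  obtain ⟨hnp, hdim⟩ := hC
  have h1 : Simple (𝟙_ C) := IsFusionCategory.simple_unit
  have hx1 := f.not_iso_unit hf (id_nonzero _)
  obtain ⟨s₀, hs₀, hs₀i⟩ : ∃ s : C, Simple s ∧ ¬ IsInvertibleObj s := by
    simpa [IsPointed] using hnp
  have h := isingFusion hdim f.tensor_self_iso hx1 hs₀ hs₀i
  obtain ⟨_⟩ := h.pairing
  obtain ⟨S, hS⟩ := exists_signStructure h hs₀i
  have hiso : ∀ s : C, Simple s → ¬ IsInvertibleObj s → Nonempty (s ≅ s₀) := by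
    intro s hs hsi
    rcases h.exhaust s hs with ⟨⟨e⟩⟩ | ⟨⟨e⟩⟩ | e
    · exact absurd (isInvertibleObj_unit.of_iso e.symm) hsi
    · exact absurd ((isInvertibleObj_of_square h.x_square).of_iso e.symm) hsi
    · exact e
  have huniq : ∀ (T : Discrete G ⥤ f.FermionicAut) [T.Monoidal] (β β' : H2Z2 G),
      S.HasClass T β → S.HasClass T β' → β = β' := by
    intro T _ β β' hβ hβ'
    refine HasClassAt.unique (id_nonzero s₀) (fun a => ?_)
      ((hasClassAt_iff_hasClass T h S hS β).2 hβ) ((hasClassAt_iff_hasClass T h S hS β').2 hβ')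
    obtain ⟨z, hz⟩ := fermionicAut_hom_app_s h (𝟙 (𝟙_ f.FermionicAut)) (ObjectProperty.homMk a)
    exact ⟨z, hz⟩
  have hreal : ∀ β : H2Z2 G, ∃ T : FermionicAction f G 0, S.HasClass T.functor β := by
    intro β
    obtain ⟨T, _, hT⟩ := S.exists_functor β
    exact ⟨⟨T, hasClassAt_rest_zero T h S⟩, hT⟩
  have hcl : ∀ T : FermionicAction f G 0, ∃ β, S.HasClass T.functor β := fun T =>
    S.exists_hasClass T.functor
  choose c hc using hcl
  refine ⟨fun α => ⟨?_, ?_⟩, ?_⟩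
  · rintro ⟨T⟩
    exact eq_zero_of_hasClassAt_rest T.functor h S T.restriction
  · rintro rfl
    exact ⟨(hreal 0).choose⟩
  · let c' : FermionicAction.Classes f G 0 → H2Z2 G := Quotient.lift c (by
      rintro T T' ⟨e, he⟩
      exact huniq T'.functor _ _ ((hc T).of_iso S e.hom) (hc T'))
    have hbij : Function.Bijective c' := by
      constructor
      · rintro ⟨T⟩ ⟨T'⟩ hTT
        have hTT' : c T = c T' := hTT
        exact Quotient.sound (S.exists_iso_of_hasClass (hTT' ▸ hc T) (hc T'))
      · intro β
        obtain ⟨T, hT⟩ := hreal β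
        exact ⟨T.toClass, huniq T.functor _ _ (hc T) hT⟩
    refine ⟨Equiv.ofBijective c' hbij, fun T s hs hsi β => ?_⟩
    obtain ⟨i⟩ := hiso s hs hsi
    have hT : HasClassAt T.bosonic s β ↔ S.HasClass T.functor β :=
      ⟨fun hβ => (hasClassAt_iff_hasClass T.functor h S hS β).1 (hβ.of_iso i),
        fun hβ => HasClassAt.of_iso i.symm ((hasClassAt_iff_hasClass T.functor h S hS β).2 hβ)⟩
    rw [hT]
    exact ⟨fun hβ => hβ ▸ hc T, fun hβ => huniq T.functor _ _ (hc T) hβ⟩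

end
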